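/- Let $\gamma_1,\gamma_2\in(-1,-1/2)$ with $\gamma_1+\gamma_2>-3/2$. Let $B$ be a Brownian random measure on $\mathbb{R}$ (a centred, jointly Gaussian family $B(S)$, indexed by the Borel sets $S$ of finite Lebesgue measure, with $\mathbb{E}[B(S)B(T)]=|S\cap T|$). For $A>0$ let \[ Z^{A}=\frac A2\int_{\mathbb{R}^2}'\int_0^1\big[(s-x_1)_+^{\gamma_1}(s-x_2)_+^{\gamma_2}+(s-x_1)_+^{\gamma_2}(s-x_2)_+^{\gamma_1}\big]\,ds\;B(dx_1)B(dx_2) \] (a double Wiener–Itô integral, the prime meaning that the diagonal $x_1=x_2$ is excluded) be the generalized Rosenblatt random variable. Write $\mathrm{B}(x,y)=\Gamma(x)\Gamma(y)/\Gamma(x+y)$ for the beta function. Then the only constant $A>0$ for which $Z^A$ has variance $1$ is \[ A(\gamma_1,\gamma_2)=\left(\frac{(\gamma_1+\gamma_2+2)(2(\gamma_1+\gamma_2)+3)}{\mathrm{B}(\gamma_1+1,-\gamma_1-\gamma_2-1)\,\mathrm{B}(\gamma_2+1,-\gamma_1-\gamma_2-1)+\mathrm{B}(\gamma_1+1,-2\gamma_1-1)\,\mathrm{B}(\gamma_2+1,-2\gamma_2-1)}\right)^{1/2},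 \] which is itself positive. With $A=A(\gamma_1,\gamma_2)$, the variable $Z=Z^{A}$ has a finite third absolute moment, mean $0$, and third moment \[ \mathbb{E}[Z^3]=F_1(\gamma_1,\gamma_2)\,F_2(\gamma_1,\gamma_2)\,F_3(\gamma_1,\gamma_2), \] where \[ F_1(\gamma_1,\gamma_2)=2(\gamma_1+\gamma_2+2)^{1/2}(2(\gamma_1+\gamma_2)+3)^{3/2}(3(\gamma_1+\gamma_2)+5)^{-1}, \] \begin{align*} F_2(\gamma_1,\gamma_2)=\sum_{\sigma\in\{1,2\}^3}&\mathrm{B}(\gamma_{\sigma_1}+1,-\gamma_{\sigma_1}-\gamma_{\sigma_3'}-1)\,\mathrm{B}(\gamma_{\sigma_1'}+1,-\gamma_{\sigma_1'}-\gamma_{\sigma_2}-1)\,\mathrm{B}(\gamma_{\sigma_2'}+1,-\gamma_{\sigma_2'}-\gamma_{\sigma_3}-1)\\ &\times\mathrm{B}(\gamma_{\sigma_1'}+\gamma_{\sigma_2}+2,\gamma_{\sigma_2'}+\gamma_{\sigma_3}+2),\qquad \sigma_i'=3-\sigma_i, \end{align*} and \[ F_3(\gamma_1,\gamma_2)=\big[\mathrm{B}(\gamma_1+1,-\gamma_1-\gamma_2-1)\,\mathrm{B}(\gamma_2+1,-\gamma_1-\gamma_2-1)+\mathrm{B}(\gamma_1+1,-2\gamma_1-1)\,\mathrm{B}(\gamma_2+1,-2\gamma_2-1)\big]^{-3/2}.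 \] -/

import Mathlib

open MeasureTheory ProbabilityTheory Filter Topology
open scoped ENNReal

noncomputable section

/-- A Brownian random measure on `ℝ` (Gaussian white noise with control measure Lebesgue measure):
a centred, jointly Gaussian family `B(S)`, indexed by the Borel sets `S` of finite Lebesgue
measure, with `E[B(S) B(T)] = |S ∩ T|`. The values of `B` at other sets play no role. -/
structure IsBrownianRandomMeasure {Ω : Type*} [MeasurableSpace Ω] (P : Measure Ω)
    (B : Set ℝ → Ω → ℝ) : Prop where
  isGaussianProcess :
    IsGaussianProcess (fun S : {S : Set ℝ // MeasurableSet S ∧ volume S < ∞} => B S.1) P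
  mean_eq_zero : ∀ S : Set ℝ, MeasurableSet S → volume S < ∞ → ∫ ω, B S ω ∂P = 0
  covariance_eq : ∀ S T : Set ℝ, MeasurableSet S → volume S < ∞ →
    MeasurableSet T → volume T < ∞ → ∫ ω, B S ω * B T ω ∂P = (volume (S ∩ T)).toReal

/-- A simple function on `ℝ²` that vanishes on the diagonal: finitely many pairwise disjoint Borel
sets of finite measure, and coefficients on their products that vanish on the diagonal squares. -/
structure OffDiagSimple where
  n : ℕ
  sets : Fin n → Set ℝ
  measurableSet_sets : ∀ i, MeasurableSet (sets i)
  volume_sets_lt_top : ∀ i, volume (sets i) < ∞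
  disjoint_sets : Pairwise fun i j => Disjoint (sets i) (sets j)
  coeff : Fin n → Fin n → ℝ
  coeff_diag : ∀ i, coeff i i = 0

/-- The function `∑ i j, a i j • 1_{S i × S j}` on `ℝ²`. -/
def OffDiagSimple.toFun (φ : OffDiagSimple) (x : ℝ × ℝ) : ℝ :=
  ∑ i, ∑ j, φ.coeff i j *
    ((φ.sets i).indicator (fun _ => (1 : ℝ)) x.1 * (φ.sets j).indicator (fun _ => (1 : ℝ)) x.2)

/-- The double Wiener–Itô integral `∑ i j, a i j B(S i) B(S j)` of an off-diagonal simple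
function. -/
def OffDiagSimple.integral {Ω : Type*} (φ : OffDiagSimple) (B : Set ℝ → Ω → ℝ) (ω : Ω) : ℝ :=
  ∑ i, ∑ j, φ.coeff i j * (B (φ.sets i) ω * B (φ.sets j) ω)

/-- `X` is (a version of) the double Wiener–Itô integral of `f ∈ L²(ℝ²)`, diagonals excluded:
it is the `L²(P)`-limit of the integrals of off-diagonal simple functions that converge to `f`
in `L²(ℝ²)`. -/
def IsDoubleWienerIto {Ω : Type*} [MeasurableSpace Ω] (P : Measure Ω) (B : Set ℝ → Ω → ℝ)
    (f : ℝ × ℝ → ℝ) (X : Ω → ℝ) : Prop :=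
  MemLp f 2 volume ∧ MemLp X 2 P ∧ ∃ φ : ℕ → OffDiagSimple,
    Tendsto (fun k => eLpNorm ((φ k).toFun - f) 2 volume) atTop (𝓝 0) ∧
    Tendsto (fun k => eLpNorm ((φ k).integral B - X) 2 P) atTop (𝓝 0)

open Classical in
/-- The double Wiener–Itô integral `∫' f(x₁, x₂) B(dx₁) B(dx₂)`, a random variable defined up to
almost sure equality (set to `0` where no such variable exists). -/
def doubleWienerIto {Ω : Type*} [MeasurableSpace Ω] (P : Measure Ω) (B : Set ℝ → Ω → ℝ)
    (f : ℝ × ℝ → ℝ) : Ω → ℝ :=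
  if h : ∃ X, IsDoubleWienerIto P B f X then h.choose else 0

/-- The truncated power `u_+^γ`: equal to `u ^ γ` for `u > 0` and to `0` for `u ≤ 0`. -/
def posPow (u γ : ℝ) : ℝ := if 0 < u then u ^ γ else 0

/-- The kernel
`(A/2) ∫₀ᵗ [(s-x₁)_+^γ₁ (s-x₂)_+^γ₂ + (s-x₁)_+^γ₂ (s-x₂)_+^γ₁] ds`. -/
def genRosenblattKernel (A γ₁ γ₂ t : ℝ) (x : ℝ × ℝ) : ℝ :=
  A / 2 * ∫ s in (0 : ℝ)..t,
    (posPow (s - x.1) γ₁ * posPow (s - x.2) γ₂ + posPow (s - x.1) γ₂ * posPow (s - x.2) γ₁)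

/-- The generalized Rosenblatt process `Z_{γ₁,γ₂}(t)` with constant `A`. -/
def genRosenblatt {Ω : Type*} [MeasurableSpace Ω] (P : Measure Ω) (B : Set ℝ → Ω → ℝ)
    (A γ₁ γ₂ t : ℝ) : Ω → ℝ :=
  doubleWienerIto P B (genRosenblattKernel A γ₁ γ₂ t)

/-- The bracket of beta functions in the second moment; `beta x y = Γ(x)Γ(y)/Γ(x+y)`. -/
def betaBracket (γ₁ γ₂ : ℝ) : ℝ :=
  beta (γ₁ + 1) (-γ₁ - γ₂ - 1) * beta (γ₂ + 1) (-γ₁ - γ₂ - 1) +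
    beta (γ₁ + 1) (-2 * γ₁ - 1) * beta (γ₂ + 1) (-2 * γ₂ - 1)

/-- The normalizing constant `A(γ₁, γ₂)`. -/
def normConst (γ₁ γ₂ : ℝ) : ℝ :=
  ((γ₁ + γ₂ + 2) * (2 * (γ₁ + γ₂) + 3) / betaBracket γ₁ γ₂) ^ (1 / 2 : ℝ)

def factorF1 (γ₁ γ₂ : ℝ) : ℝ :=
  2 * (γ₁ + γ₂ + 2) ^ (1 / 2 : ℝ) * (2 * (γ₁ + γ₂) + 3) ^ (3 / 2 : ℝ) *
    (3 * (γ₁ + γ₂) + 5)⁻¹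

/-- The sum over `σ ∈ {1,2}³`. The labels `1, 2` are the elements `0, 1` of `Fin 2`, and the
complementary label is `Fin.rev`. -/
def factorF2 (γ₁ γ₂ : ℝ) : ℝ :=
  let γ : Fin 2 → ℝ := ![γ₁, γ₂]
  ∑ σ : Fin 3 → Fin 2,
    beta (γ (σ 0) + 1) (-γ (σ 0) - γ (σ 2).rev - 1) *
    beta (γ (σ 0).rev + 1) (-γ (σ 0).rev - γ (σ 1) - 1) *
    beta (γ (σ 1).rev + 1) (-γ (σ 1).rev - γ (σ 2) - 1) *
    beta (γ (σ 0).rev + γ (σ 1) + 2) (γ (σ 1).rev + γ (σ 2) + 2)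

def factorF3 (γ₁ γ₂ : ℝ) : ℝ := betaBracket γ₁ γ₂ ^ (-3 / 2 : ℝ)

end

noncomputable section

section AllMoments

variable {Ω : Type*} [MeasurableSpace Ω] {P : Measure Ω}

/-- All moments of `X` are finite. -/
def HasAllMoments (X : Ω → ℝ) (P : Measure Ω) : Prop := ∀ p : ℝ≥0∞, p ≠ ∞ → MemLp X p P

lemma HasAllMoments.mul {X Y : Ω → ℝ} (hX : HasAllMoments X P) (hY : HasAllMoments Y P) :
    HasAllMoments (fun ω => X ω * Y ω) P := by
  intro p hp
  have : ENNReal.HolderTriple (2 * p) (2 * p) p := ⟨by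
    rw [ENNReal.mul_inv (by simp) (by simp), ← two_mul, ← mul_assoc,
      ENNReal.mul_inv_cancel (by simp) (by simp), one_mul]⟩
  exact (hY (2 * p) (ENNReal.mul_ne_top (by simp) hp)).mul'
    (hX (2 * p) (ENNReal.mul_ne_top (by simp) hp))

lemma HasAllMoments.const_mul {X : Ω → ℝ} (hX : HasAllMoments X P) (c : ℝ) :
    HasAllMoments (fun ω => c * X ω) P :=
  fun p hp => (hX p hp).const_mul c

lemma HasAllMoments.add {X Y : Ω → ℝ} (hX : HasAllMoments X P) (hY : HasAllMoments Y P) :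
    HasAllMoments (fun ω => X ω + Y ω) P :=
  fun p hp => (hX p hp).add (hY p hp)

lemma HasAllMoments.sub {X Y : Ω → ℝ} (hX : HasAllMoments X P) (hY : HasAllMoments Y P) :
    HasAllMoments (fun ω => X ω - Y ω) P :=
  fun p hp => (hX p hp).sub (hY p hp)

lemma HasAllMoments.sum {ι : Type*} (s : Finset ι) {X : ι → Ω → ℝ}
    (hX : ∀ i ∈ s, HasAllMoments (X i) P) : HasAllMoments (fun ω => ∑ i ∈ s, X i ω) P :=
  fun p hp => memLp_finsetSum s fun i hi => hX i hi p hp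

lemma hasAllMoments_const [IsFiniteMeasure P] (c : ℝ) : HasAllMoments (fun _ : Ω => c) P :=
  fun _ _ => memLp_const c

lemma HasAllMoments.pow [IsFiniteMeasure P] {X : Ω → ℝ} (hX : HasAllMoments X P) (n : ℕ) :
    HasAllMoments (fun ω => X ω ^ n) P := by
  induction n with
  | zero => simpa using hasAllMoments_const 1
  | succ n ih => simpa only [pow_succ] using ih.mul hX

lemma HasAllMoments.integrable {X : Ω → ℝ} (hX : HasAllMoments X P) : Integrable X P :=
  memLp_one_iff_integrable.1 (hX 1 (by simp))

lemma ProbabilityTheory.HasGaussianLaw.hasAllMoments {X : Ω → ℝ} (hX : HasGaussianLaw X P) :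
    HasAllMoments X P := fun _ hp => hX.memLp hp

end AllMoments

section GaussianMoments

open scoped Nat in
lemma integral_pow_even_gaussianReal (k : ℕ) :
    ∫ x, x ^ (2 * k) ∂(gaussianReal 0 1) = ((2 * k - 1)‼ : ℕ) := by
  have hG := Real.Gamma_nat_add_half k
  have h1 := integral_rpow_mul_exp_neg_mul_rpow (p := 2) (q := (2 * k : ℕ)) (b := 1 / 2)
    (by norm_num) (lt_of_lt_of_le (by norm_num) (Nat.cast_nonneg _)) (by norm_num)
  have h2 : (((2 * k : ℕ) : ℝ) + 1) / 2 = k + 1 / 2 := by push_cast; ring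
  rw [neg_div, h2, hG] at h1
  rw [integral_gaussianReal_eq_integral_smul (by norm_num)]
  have h3 : ∀ x : ℝ, gaussianPDFReal 0 1 x • x ^ (2 * k) =
      (√(2 * Real.pi))⁻¹ * (fun y : ℝ => y ^ (2 * k) * Real.exp (-(1 / 2) * y ^ 2)) |x| := by
    intro x
    simp only [gaussianPDFReal, smul_eq_mul, sub_zero, NNReal.coe_one, mul_one, sq_abs]
    rw [pow_mul |x|, sq_abs, ← pow_mul, show -x ^ 2 / 2 = -(1 / 2) * x ^ 2 by ring]
    ring
  simp_rw [h3]
  rw [integral_const_mul, integral_comp_abs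
    (f := fun y : ℝ => y ^ (2 * k) * Real.exp (-(1 / 2) * y ^ 2))]
  have h4 : ∫ y in Set.Ioi (0 : ℝ), y ^ (2 * k) * Real.exp (-(1 / 2) * y ^ 2) =
      ∫ y in Set.Ioi (0 : ℝ), y ^ ((2 * k : ℕ) : ℝ) * Real.exp (-(1 / 2) * y ^ (2 : ℝ)) := by
    refine setIntegral_congr_fun measurableSet_Ioi fun y _ => ?_
    simp only [Real.rpow_natCast, Real.rpow_two]
  rw [h4, h1]
  have h5 : ((1 : ℝ) / 2) ^ (-((k : ℝ) + 1 / 2)) = 2 ^ k * √2 := by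
    rw [one_div, Real.inv_rpow (by norm_num), ← Real.rpow_neg (by norm_num), neg_neg,
      Real.rpow_add (by norm_num), Real.rpow_natCast, ← one_div, ← Real.sqrt_eq_rpow]
  rw [h5, Real.sqrt_mul (by norm_num)]
  have : √Real.pi ≠ 0 := by positivity
  field_simp

variable {Ω : Type*} [MeasurableSpace Ω] {P : Measure Ω}

lemma integral_pow_four_of_hasGaussianLaw {X : Ω → ℝ} (hX : HasGaussianLaw X P)
    (h0 : ∫ ω, X ω ∂P = 0) : ∫ ω, X ω ^ 4 ∂P = 3 * (∫ ω, X ω ^ 2 ∂P) ^ 2 := by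
  have hm := hX.map_eq_gaussianReal
  have hP := hX.isProbabilityMeasure
  set v := Var[X; P].toNNReal
  rw [h0] at hm
  have hs : gaussianReal 0 v = (gaussianReal 0 1).map (fun x => √v * x) := by
    rw [gaussianReal_map_const_mul]
    congr 1
    · simp
    · ext; simp
  have key : ∀ n : ℕ, ∫ ω, X ω ^ (2 * n) ∂P = v ^ n * ∫ x, x ^ (2 * n) ∂(gaussianReal 0 1) := by
    intro n
    rw [← integral_map (f := fun x : ℝ => x ^ (2 * n)) hX.aemeasurable (by fun_prop), hm, hs,
      integral_map (by fun_prop) (by fun_prop), ← integral_const_mul]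
    refine integral_congr_ae (ae_of_all _ fun x => ?_)
    simp only [mul_pow]
    rw [pow_mul (√(v : ℝ)), Real.sq_sqrt (by positivity)]
  have h2 := key 1
  have h4 := key 2
  rw [integral_pow_even_gaussianReal] at h2 h4
  simp only [Nat.doubleFactorial, mul_one] at h2 h4
  rw [h2, h4]
  norm_num [Nat.doubleFactorial]
  ring

/-- **Wick's formula** (Isserlis' theorem) for four jointly Gaussian centred variables. -/
lemma integral_mul_four_of_hasGaussianLaw {X : Fin 4 → Ω → ℝ}
    (hX : HasGaussianLaw (fun ω => (X · ω)) P) (h0 : ∀ i, ∫ ω, X i ω ∂P = 0) :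
    ∫ ω, X 0 ω * X 1 ω * X 2 ω * X 3 ω ∂P =
      (∫ ω, X 0 ω * X 1 ω ∂P) * (∫ ω, X 2 ω * X 3 ω ∂P) +
      (∫ ω, X 0 ω * X 2 ω ∂P) * (∫ ω, X 1 ω * X 3 ω ∂P) +
      (∫ ω, X 0 ω * X 3 ω ∂P) * (∫ ω, X 1 ω * X 2 ω ∂P) := by
  have hP := hX.isProbabilityMeasure
  have hM : ∀ i, HasAllMoments (X i) P := fun i => (hX.eval i).hasAllMoments
  have hMM : ∀ i j, HasAllMoments (fun ω => X i ω * X j ω) P := fun i j => (hM i).mul (hM j)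
  have hI : ∀ c : Fin 4 → ℝ, ∫ ω, (∑ i, c i * X i ω) ^ 4 ∂P =
      3 * (∑ i, ∑ j, c i * c j * ∫ ω, X i ω * X j ω ∂P) ^ 2 := by
    intro c
    have hg : HasGaussianLaw (fun ω => ∑ i, c i * X i ω) P := by
      have := hX.map_fun (∑ i, c i • ContinuousLinearMap.proj (R := ℝ) (φ := fun _ : Fin 4 => ℝ) i)
      simpa using this
    rw [integral_pow_four_of_hasGaussianLaw hg]
    · congr 2
      have : ∀ ω, (∑ i, c i * X i ω) ^ 2 = ∑ i, ∑ j, c i * c j * (X i ω * X j ω) := by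
        intro ω
        rw [sq, Finset.sum_mul_sum]
        exact Finset.sum_congr rfl fun i _ => Finset.sum_congr rfl fun j _ => by ring
      simp_rw [this]
      rw [integral_finsetSum _ fun i _ => integrable_finsetSum _ fun j _ =>
        ((hMM i j).const_mul _).integrable]
      refine Finset.sum_congr rfl fun i _ => ?_
      rw [integral_finsetSum _ fun j _ => ((hMM i j).const_mul _).integrable]
      simp_rw [integral_const_mul]
    · rw [integral_finsetSum _ fun i _ => ((hM i).const_mul _).integrable]
      simp_rw [integral_const_mul, h0]
      simp
  have hint : ∀ c : Fin 4 → ℝ, Integrable (fun ω => (∑ i, c i * X i ω) ^ 4) P := fun c =>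
    ((HasAllMoments.sum Finset.univ fun i _ => (hM i).const_mul (c i)).pow 4).integrable
  have hpol : ∀ ω, X 0 ω * X 1 ω * X 2 ω * X 3 ω = 1 / 192 *
      ∑ e : Fin 2 × Fin 2 × Fin 2, (-1) ^ (e.1 + e.2.1 + e.2.2 : ℕ) *
        (∑ i, ![1, (-1) ^ (e.1 : ℕ), (-1) ^ (e.2.1 : ℕ), (-1) ^ (e.2.2 : ℕ)] i * X i ω) ^ 4 := by
    intro ω
    simp [Fintype.sum_prod_type, Fin.sum_univ_succ]
    ring
  have hsym : ∀ i j, ∫ ω, X i ω * X j ω ∂P = ∫ ω, X j ω * X i ω ∂P := fun i j =>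
    integral_congr_ae (ae_of_all _ fun ω => mul_comm _ _)
  simp_rw [hpol]
  rw [integral_const_mul, integral_finsetSum _ fun e _ => (hint _).const_mul _]
  simp_rw [integral_const_mul, hI]
  simp [Fintype.sum_prod_type, Fin.sum_univ_succ, hsym 1 0, hsym 2 0, hsym 3 0, hsym 2 1, hsym 3 1,
    hsym 3 2]
  ring

end GaussianMoments

section QuadraticForms

open scoped Matrix

variable {Ω : Type*} [MeasurableSpace Ω] {P : Measure Ω}

lemma ProbabilityTheory.IndepFun.integral_pow_mul_pow [IsProbabilityMeasure P] {X Y : Ω → ℝ}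
    (h : IndepFun X Y P) (hX : HasAllMoments X P) (hY : HasAllMoments Y P) (a b : ℕ) :
    ∫ ω, X ω ^ a * Y ω ^ b ∂P = (∫ ω, X ω ^ a ∂P) * ∫ ω, Y ω ^ b ∂P := by
  have h' := h.comp (φ := fun x => x ^ a) (ψ := fun x => x ^ b) (by fun_prop) (by fun_prop)
  exact h'.integral_fun_mul_eq_mul_integral (hX.pow a).integrable.aestronglyMeasurable
    (hY.pow b).integrable.aestronglyMeasurable

lemma integral_add_pow_of_indepFun [IsProbabilityMeasure P] {X Y : Ω → ℝ}
    (h : IndepFun X Y P) (hX : HasAllMoments X P) (hY : HasAllMoments Y P) (n : ℕ) :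
    ∫ ω, (X ω + Y ω) ^ n ∂P = ∑ k ∈ Finset.range (n + 1),
      (∫ ω, X ω ^ k ∂P) * (∫ ω, Y ω ^ (n - k) ∂P) * (n.choose k : ℝ) := by
  simp_rw [add_pow]
  rw [integral_finsetSum _ fun k _ =>
    (((hX.pow k).mul (hY.pow (n - k))).integrable.mul_const _)]
  simp_rw [integral_mul_const, h.integral_pow_mul_pow hX hY]

lemma integral_standard_sq_sub_one_pow [IsProbabilityMeasure P] {X : Ω → ℝ}
    (hX : P.map X = gaussianReal 0 1) (hXm : AEMeasurable X P) :
    ∫ ω, (X ω ^ 2 - 1) ∂P = 0 ∧ ∫ ω, (X ω ^ 2 - 1) ^ 2 ∂P = 2 ∧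
    ∫ ω, (X ω ^ 2 - 1) ^ 3 ∂P = 8 ∧ ∫ ω, (X ω ^ 2 - 1) ^ 4 ∂P = 60 := by
  have hid : HasGaussianLaw (fun x : ℝ => x) (gaussianReal 0 1) := IsGaussian.hasGaussianLaw_id
  have hm : ∀ k : ℕ, Integrable (fun x : ℝ => x ^ k) (gaussianReal 0 1) := fun k =>
    (hid.hasAllMoments.pow k).integrable
  have tr : ∀ f : ℝ → ℝ, Continuous f → ∫ ω, f (X ω) ∂P = ∫ x, f x ∂(gaussianReal 0 1) := by
    intro f hf
    rw [← hX, integral_map hXm hf.aestronglyMeasurable]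
  have hk : ∀ n : ℕ, ∫ x, (x ^ 2 - 1) ^ n ∂(gaussianReal 0 1) =
      ∑ k ∈ Finset.range (n + 1), ((2 * k - 1).doubleFactorial : ℝ) * ((-1) ^ (n - k) *
        (n.choose k : ℝ)) := by
    intro n
    simp_rw [sub_eq_add_neg, add_pow, ← pow_mul, mul_assoc]
    rw [integral_finsetSum _ fun k _ => (hm _).mul_const _]
    simp_rw [integral_mul_const, integral_pow_even_gaussianReal]
  refine ⟨?_, ?_, ?_, ?_⟩
  · rw [tr (fun x => x ^ 2 - 1) (by fun_prop)]
    simpa [Finset.sum_range_succ, Nat.doubleFactorial] using hk 1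
  · rw [tr (fun x => (x ^ 2 - 1) ^ 2) (by fun_prop), hk]
    norm_num [Finset.sum_range_succ, Nat.doubleFactorial, Nat.choose]
  · rw [tr (fun x => (x ^ 2 - 1) ^ 3) (by fun_prop), hk]
    norm_num [Finset.sum_range_succ, Nat.doubleFactorial, Nat.choose]
  · rw [tr (fun x => (x ^ 2 - 1) ^ 4) (by fun_prop), hk]
    norm_num [Finset.sum_range_succ, Nat.doubleFactorial, Nat.choose]

/-- The first four moments of a weighted sum of independent centred `χ²(1)` variables. -/
lemma moments_sum_sq_sub_one [IsProbabilityMeasure P] {ι : Type*} {η : ι → Ω → ℝ}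
    (hη : iIndepFun η P) (hm : ∀ i, AEMeasurable (η i) P)
    (hlaw : ∀ i, P.map (η i) = gaussianReal 0 1) (l : ι → ℝ) (s : Finset ι) :
    HasAllMoments (fun ω => ∑ i ∈ s, l i * (η i ω ^ 2 - 1)) P ∧
    ∫ ω, (∑ i ∈ s, l i * (η i ω ^ 2 - 1)) ∂P = 0 ∧
    ∫ ω, (∑ i ∈ s, l i * (η i ω ^ 2 - 1)) ^ 2 ∂P = 2 * ∑ i ∈ s, l i ^ 2 ∧
    ∫ ω, (∑ i ∈ s, l i * (η i ω ^ 2 - 1)) ^ 3 ∂P = 8 * ∑ i ∈ s, l i ^ 3 ∧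
    ∫ ω, (∑ i ∈ s, l i * (η i ω ^ 2 - 1)) ^ 4 ∂P ≤ 15 * (2 * ∑ i ∈ s, l i ^ 2) ^ 2 := by
  classical
  have hMη : ∀ i, HasAllMoments (η i) P := fun i => by
    have : IsGaussian (P.map (η i)) := by rw [hlaw]; infer_instance
    exact (HasGaussianLaw.mk this).hasAllMoments
  have hMY : ∀ i, HasAllMoments (fun ω => l i * (η i ω ^ 2 - 1)) P := fun i =>
    (((hMη i).pow 2).sub (hasAllMoments_const 1)).const_mul _
  induction s using Finset.induction_on with
  | empty => simpa using hasAllMoments_const 0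
  | insert a s ha ih =>
    obtain ⟨h0, h1, h2, h3, h4⟩ := ih
    have hind : IndepFun (fun ω => l a * (η a ω ^ 2 - 1))
        (fun ω => ∑ i ∈ s, l i * (η i ω ^ 2 - 1)) P := by
      have := (hη.comp (fun i x => l i * (x ^ 2 - 1)) fun i => by fun_prop)
      have := this.indepFun_finsetSum_of_notMem₀ (fun i => by
        have := hm i
        simp only [Function.comp_def]; fun_prop) ha
      convert this.symm using 1
      all_goals ext ω; simp
    obtain ⟨e1, e2, e3, e4⟩ := integral_standard_sq_sub_one_pow (hlaw a) (hm a)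
    simp_rw [Finset.sum_insert ha]
    have hI := integral_add_pow_of_indepFun hind (hMY a) h0
    refine ⟨(hMY a).add h0, ?_, ?_, ?_, ?_⟩
    · rw [integral_add (hMY a).integrable h0.integrable, h1, integral_const_mul, e1]
      simp
    · rw [hI 2]
      simp only [Finset.sum_range_succ, Finset.sum_range_zero, mul_pow, integral_const_mul, e2, h2]
      simp [h1]
      ring
    · rw [hI 3]
      simp only [Finset.sum_range_succ, Finset.sum_range_zero, mul_pow, integral_const_mul, e2, e3,
        h2, h3]
      simp [h1, e1]
      ring
    · rw [hI 4]
      simp only [Finset.sum_range_succ, Finset.sum_range_zero, mul_pow, integral_const_mul, e2, e3,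
        e4, h2, h3]
      simp [h1, e1, Nat.choose]
      nlinarith [h4, mul_nonneg (sq_nonneg (l a)) (Finset.sum_nonneg fun i (_ : i ∈ s) => sq_nonneg (l i))]

/-- Moments of a quadratic form with symmetric traceless matrix in a standard Gaussian vector. -/
lemma moments_quadraticForm_standard [IsProbabilityMeasure P] {ι : Type*} [Fintype ι]
    [DecidableEq ι] {ξ : ι → Ω → ℝ} (hξ : HasGaussianLaw (fun ω => (ξ · ω)) P)
    (h0 : ∀ i, ∫ ω, ξ i ω ∂P = 0)
    (hcov : ∀ i j, ∫ ω, ξ i ω * ξ j ω ∂P = if i = j then 1 else 0)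
    (c : Matrix ι ι ℝ) (hc : c.IsSymm) (htr : c.trace = 0) :
    HasAllMoments (fun ω => ∑ i, ∑ j, c i j * (ξ i ω * ξ j ω)) P ∧
    ∫ ω, (∑ i, ∑ j, c i j * (ξ i ω * ξ j ω)) ∂P = 0 ∧
    ∫ ω, (∑ i, ∑ j, c i j * (ξ i ω * ξ j ω)) ^ 2 ∂P = 2 * (c * c).trace ∧
    ∫ ω, (∑ i, ∑ j, c i j * (ξ i ω * ξ j ω)) ^ 3 ∂P = 8 * (c * c * c).trace ∧
    ∫ ω, (∑ i, ∑ j, c i j * (ξ i ω * ξ j ω)) ^ 4 ∂P ≤ 15 * (2 * (c * c).trace) ^ 2 := by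
  have hH : c.IsHermitian := by
    rw [Matrix.IsHermitian, Matrix.conjTranspose_eq_transpose_of_trivial]; exact hc
  set U : Matrix ι ι ℝ := (hH.eigenvectorUnitary : Matrix ι ι ℝ) with hU
  set l := hH.eigenvalues with hl
  have hUU : Uᵀ * U = 1 := by
    have := Unitary.coe_star_mul_self hH.eigenvectorUnitary
    rwa [Matrix.star_eq_conjTranspose, Matrix.conjTranspose_eq_transpose_of_trivial] at this
  have hspec : c = U * Matrix.diagonal l * Uᵀ := by
    have := hH.spectral_theorem
    rw [Unitary.conjStarAlgAut_apply, Matrix.star_eq_conjTranspose,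
      Matrix.conjTranspose_eq_transpose_of_trivial] at this
    simpa [Function.comp_def] using this
  have hc2 : c * c = U * Matrix.diagonal (fun i => l i ^ 2) * Uᵀ := by
    calc c * c = U * Matrix.diagonal l * (Uᵀ * U) * Matrix.diagonal l * Uᵀ := by
          conv_lhs => rw [hspec]
          simp only [Matrix.mul_assoc]
      _ = _ := by
          rw [hUU, Matrix.mul_one, Matrix.mul_assoc U, Matrix.diagonal_mul_diagonal]
          simp only [sq]
  have hc3 : c * c * c = U * Matrix.diagonal (fun i => l i ^ 3) * Uᵀ := by
    calc c * c * c = U * Matrix.diagonal (fun i => l i ^ 2) * (Uᵀ * U) * Matrix.diagonal l * Uᵀ := by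
          rw [hc2]
          conv_lhs => rw [hspec]
          simp only [Matrix.mul_assoc]
      _ = _ := by
          rw [hUU, Matrix.mul_one, Matrix.mul_assoc U, Matrix.diagonal_mul_diagonal]
          simp only [pow_succ]
  have htrace : ∀ d : ι → ℝ, (U * Matrix.diagonal d * Uᵀ).trace = ∑ i, d i := by
    intro d
    rw [Matrix.trace_mul_comm, ← Matrix.mul_assoc, hUU, Matrix.one_mul, Matrix.trace_diagonal]
  set η : ι → Ω → ℝ := fun k ω => ∑ i, U i k * ξ i ω with hη
  have hηG : HasGaussianLaw (fun ω => (η · ω)) P := by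
    exact hξ.map_fun (LinearMap.toContinuousLinearMap (Matrix.toLin' Uᵀ))
  have hMξ : ∀ i, HasAllMoments (ξ i) P := fun i => (hξ.eval i).hasAllMoments
  have hη0 : ∀ k, ∫ ω, η k ω ∂P = 0 := by
    intro k
    rw [integral_finsetSum _ fun i _ => ((hMξ i).const_mul _).integrable]
    simp [integral_const_mul, h0]
  have hηcov : ∀ k k', ∫ ω, η k ω * η k' ω ∂P = if k = k' then 1 else 0 := by
    intro k k'
    have : ∀ ω, η k ω * η k' ω = ∑ i, ∑ j, U i k * U j k' * (ξ i ω * ξ j ω) := by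
      intro ω
      rw [hη, Finset.sum_mul_sum]
      exact Finset.sum_congr rfl fun i _ => Finset.sum_congr rfl fun j _ => by ring
    simp_rw [this]
    rw [integral_finsetSum _ fun i _ => integrable_finsetSum _ fun j _ =>
        (((hMξ i).mul (hMξ j)).const_mul _).integrable]
    simp_rw [fun i => integral_finsetSum (μ := P) Finset.univ
      (f := fun j ω => U i k * U j k' * (ξ i ω * ξ j ω)) fun j _ =>
        (((hMξ i).mul (hMξ j)).const_mul _).integrable, integral_const_mul, hcov]
    have := congrFun (congrFun hUU k) k'
    simpa [Matrix.mul_apply, Matrix.one_apply] using this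
  have hind : iIndepFun η P := hηG.iIndepFun_of_covariance_eq_zero fun i j hij => by
    rw [covariance_eq_sub (hηG.eval i).memLp_two (hηG.eval j).memLp_two, hη0]
    simpa [hij] using hηcov i j
  have hlaw : ∀ i, P.map (η i) = gaussianReal 0 1 := by
    intro i
    rw [(hηG.eval i).map_eq_gaussianReal, hη0, variance_eq_sub (hηG.eval i).memLp_two, hη0]
    have := hηcov i i
    simp only [if_true, ← sq] at this
    simp [this]
  have hQ : ∀ ω, ∑ i, ∑ j, c i j * (ξ i ω * ξ j ω) = ∑ k, l k * (η k ω ^ 2 - 1) := by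
    intro ω
    have hl0 : ∑ k, l k = 0 := by rw [← htrace, ← hspec, htr]
    have hcij : ∀ i j, c i j = ∑ k, U i k * l k * U j k := by
      intro i j
      conv_lhs => rw [hspec]
      rw [Matrix.mul_apply]
      simp [Matrix.mul_diagonal]
    have h1 : ∑ k, l k * (η k ω ^ 2 - 1) = ∑ k, l k * η k ω ^ 2 := by
      simp_rw [mul_sub, Finset.sum_sub_distrib, mul_one, hl0, sub_zero]
    rw [h1]
    simp_rw [hη, sq, Finset.sum_mul_sum, hcij, Finset.sum_mul, Finset.mul_sum]
    rw [Finset.sum_comm' (t' := Finset.univ) (s' := fun _ => Finset.univ) (by simp)]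
    conv_rhs => rw [Finset.sum_comm]
    rw [Finset.sum_comm]
    refine Finset.sum_congr rfl fun i _ => ?_
    rw [Finset.sum_comm]
    refine Finset.sum_congr rfl fun j _ => Finset.sum_congr rfl fun k _ => by ring
  simp_rw [hQ]
  have := moments_sum_sq_sub_one hind (fun i => (hηG.eval i).aemeasurable) hlaw l Finset.univ
  rwa [hc3, hc2, htrace, htrace]

/-- Moments of an off-diagonal quadratic form in independent centred Gaussian variables. -/
lemma moments_quadraticForm_offDiag [IsProbabilityMeasure P] {ι : Type*} [Fintype ι]
    [DecidableEq ι] {X : ι → Ω → ℝ} (hX : HasGaussianLaw (fun ω => (X · ω)) P)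
    (h0 : ∀ i, ∫ ω, X i ω ∂P = 0) (m : ι → ℝ) (hm : ∀ i, 0 ≤ m i)
    (hcov : ∀ i j, ∫ ω, X i ω * X j ω ∂P = if i = j then m i else 0)
    (b : ι → ι → ℝ) (hb : ∀ i j, b i j = b j i) (hd : ∀ i, b i i = 0) :
    HasAllMoments (fun ω => ∑ i, ∑ j, b i j * (X i ω * X j ω)) P ∧
    ∫ ω, (∑ i, ∑ j, b i j * (X i ω * X j ω)) ∂P = 0 ∧
    ∫ ω, (∑ i, ∑ j, b i j * (X i ω * X j ω)) ^ 2 ∂P = 2 * ∑ i, ∑ j, b i j ^ 2 * (m i * m j) ∧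
    ∫ ω, (∑ i, ∑ j, b i j * (X i ω * X j ω)) ^ 3 ∂P =
      8 * ∑ i, ∑ j, ∑ k, b i j * b j k * b k i * (m i * m j * m k) ∧
    ∫ ω, (∑ i, ∑ j, b i j * (X i ω * X j ω)) ^ 4 ∂P ≤
      15 * (2 * ∑ i, ∑ j, b i j ^ 2 * (m i * m j)) ^ 2 := by
  have hMX : ∀ i, HasAllMoments (X i) P := fun i => (hX.eval i).hasAllMoments
  have hind : iIndepFun X P := hX.iIndepFun_of_covariance_eq_zero fun i j hij => by
    rw [covariance_eq_sub (hX.eval i).memLp_two (hX.eval j).memLp_two, h0]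
    simpa [hij] using hcov i j
  have hlaw : ∀ i, P.map (X i) = (gaussianReal 0 1).map (fun x => √(m i) * x) := by
    intro i
    rw [(hX.eval i).map_eq_gaussianReal, h0, variance_eq_sub (hX.eval i).memLp_two, h0,
      gaussianReal_map_const_mul]
    have := hcov i i
    simp only [if_true, ← sq] at this
    congr 1
    · simp
    · ext
      simp [this, hm]
  have hjoint : P.map (fun ω => (X · ω)) =
      (Measure.pi fun _ : ι => gaussianReal 0 1).map (fun x i => √(m i) * x i) := by
    rw [hind.map_fun_eq_pi_map fun i => (hX.eval i).aemeasurable]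
    simp_rw [hlaw]
    have (i : ι) : SigmaFinite ((gaussianReal 0 1).map (fun x : ℝ => √(m i) * x)) := by
      have : IsProbabilityMeasure ((gaussianReal 0 1).map (fun x : ℝ => √(m i) * x)) :=
        Measure.isProbabilityMeasure_map (by fun_prop)
      infer_instance
    rw [Measure.pi_map_pi fun i => by fun_prop]
  set ν := Measure.pi fun _ : ι => gaussianReal 0 1
  have tr : ∀ f : (ι → ℝ) → ℝ, Continuous f →
      ∫ ω, f (fun i => X i ω) ∂P = ∫ x, f (fun i => √(m i) * x i) ∂ν := by
    intro f hf
    rw [← integral_map (φ := fun ω i => X i ω) hX.aemeasurable hf.aestronglyMeasurable, hjoint,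
      integral_map (Measurable.aemeasurable (by fun_prop)) hf.aestronglyMeasurable]
  have hevm : ∀ i, Measurable fun x : ι → ℝ => x i := measurable_pi_apply
  have hev : ∀ i, ν.map (fun x => x i) = gaussianReal 0 1 := fun i =>
    (measurePreserving_eval (fun _ : ι => gaussianReal 0 1) i).map_eq
  have hevG : ∀ i, HasGaussianLaw (fun x : ι → ℝ => x i) ν := fun i =>
    HasGaussianLaw.mk (by rw [hev]; infer_instance)
  have hν : iIndepFun (fun (i : ι) (x : ι → ℝ) => x i) ν :=
    iIndepFun_pi (X := fun _ x => x) fun _ => by fun_prop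
  have hξ : HasGaussianLaw (fun x : ι → ℝ => (x ·)) ν := hν.hasGaussianLaw hevG
  have hξ0 : ∀ i, ∫ x : ι → ℝ, x i ∂ν = 0 := by
    intro i
    rw [← integral_map (φ := fun x : ι → ℝ => x i) (f := fun y => y) (hevm i).aemeasurable
      (by fun_prop),
      hev]
    exact integral_id_gaussianReal
  have hξc : ∀ i j, ∫ x : ι → ℝ, x i * x j ∂ν = if i = j then 1 else 0 := by
    intro i j
    split_ifs with hij
    · subst hij
      simp_rw [← sq]
      rw [← integral_map (φ := fun x : ι → ℝ => x i) (f := fun y => y ^ 2)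
        (hevm i).aemeasurable (by fun_prop), hev]
      simpa using integral_pow_even_gaussianReal 1
    · rw [(hν.indepFun hij).integral_fun_mul_eq_mul_integral (hevm i).aestronglyMeasurable
        (hevm j).aestronglyMeasurable, hξ0,
        zero_mul]
  set c : Matrix ι ι ℝ := Matrix.of fun i j => √(m i) * b i j * √(m j) with hc
  obtain ⟨-, q1, q2, q3, q4⟩ := moments_quadraticForm_standard (ξ := fun i (x : ι → ℝ) => x i) hξ hξ0 hξc c
    (by ext i j; simp [hc, hb i j]; ring) (by simp [Matrix.trace, hc, hd])
  have hQ : ∀ x : ι → ℝ, ∑ i, ∑ j, b i j * (√(m i) * x i * (√(m j) * x j)) =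
      ∑ i, ∑ j, c i j * (x i * x j) := fun x =>
    Finset.sum_congr rfl fun i _ => Finset.sum_congr rfl fun j _ => by
      simp only [hc, Matrix.of_apply]; ring
  have ht2 : (c * c).trace = ∑ i, ∑ j, b i j ^ 2 * (m i * m j) := by
    simp only [Matrix.trace, Matrix.diag, Matrix.mul_apply]
    refine Finset.sum_congr rfl fun i _ => Finset.sum_congr rfl fun j _ => ?_
    simp only [hc, Matrix.of_apply]
    rw [hb j i, ← Real.mul_self_sqrt (hm i), ← Real.mul_self_sqrt (hm j)]
    simp only [Real.sqrt_mul_self (Real.sqrt_nonneg _)]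
    ring
  have ht3 : (c * c * c).trace = ∑ i, ∑ j, ∑ k, b i j * b j k * b k i * (m i * m j * m k) := by
    simp only [Matrix.trace, Matrix.diag, Matrix.mul_apply, Finset.sum_mul]
    refine Finset.sum_congr rfl fun i _ => ?_
    rw [Finset.sum_comm]
    refine Finset.sum_congr rfl fun j _ => Finset.sum_congr rfl fun k _ => ?_
    simp only [hc, Matrix.of_apply]
    rw [← Real.mul_self_sqrt (hm i), ← Real.mul_self_sqrt (hm j), ← Real.mul_self_sqrt (hm k)]
    simp only [Real.sqrt_mul_self (Real.sqrt_nonneg _)]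
    ring
  rw [ht2] at q2 q4
  rw [ht3] at q3
  refine ⟨HasAllMoments.sum _ fun i _ => HasAllMoments.sum _ fun j _ =>
    ((hMX i).mul (hMX j)).const_mul _, ?_, ?_, ?_, ?_⟩
  · rw [tr (fun x => ∑ i, ∑ j, b i j * (x i * x j)) (by fun_prop)]
    simpa only [hQ] using q1
  · rw [tr (fun x => (∑ i, ∑ j, b i j * (x i * x j)) ^ 2) (by fun_prop)]
    simpa only [hQ] using q2
  · rw [tr (fun x => (∑ i, ∑ j, b i j * (x i * x j)) ^ 3) (by fun_prop)]
    simpa only [hQ] using q3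
  · rw [tr (fun x => (∑ i, ∑ j, b i j * (x i * x j)) ^ 4) (by fun_prop)]
    simpa only [hQ] using q4

end QuadraticForms

section SimpleIntegrals

variable {Ω : Type*} {B : Set ℝ → Ω → ℝ}

namespace OffDiagSimple

/-- The symmetrization of an off-diagonal simple function. -/
def symmetrize (φ : OffDiagSimple) : OffDiagSimple where
  n := φ.n
  sets := φ.sets
  measurableSet_sets := φ.measurableSet_sets
  volume_sets_lt_top := φ.volume_sets_lt_top
  disjoint_sets := φ.disjoint_sets
  coeff i j := (φ.coeff i j + φ.coeff j i) / 2
  coeff_diag i := by simp [φ.coeff_diag]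

lemma symmetrize_integral (φ : OffDiagSimple) : φ.symmetrize.integral B = φ.integral B := by
  ext ω
  change ∑ i : Fin φ.n, ∑ j : Fin φ.n, (φ.coeff i j + φ.coeff j i) / 2 *
    (B (φ.sets i) ω * B (φ.sets j) ω) = ∑ i, ∑ j, φ.coeff i j * (B (φ.sets i) ω * B (φ.sets j) ω)
  have h : ∑ i, ∑ j, φ.coeff j i * (B (φ.sets i) ω * B (φ.sets j) ω) =
      ∑ i, ∑ j, φ.coeff i j * (B (φ.sets i) ω * B (φ.sets j) ω) := by
    rw [Finset.sum_comm]
    exact Finset.sum_congr rfl fun i _ => Finset.sum_congr rfl fun j _ => by ring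
  have h' : ∀ i j, (φ.coeff i j + φ.coeff j i) / 2 * (B (φ.sets i) ω * B (φ.sets j) ω) =
      φ.coeff i j * (B (φ.sets i) ω * B (φ.sets j) ω) / 2 +
      φ.coeff j i * (B (φ.sets i) ω * B (φ.sets j) ω) / 2 := fun i j => by ring
  simp_rw [h', Finset.sum_add_distrib, ← Finset.sum_div, h]
  ring

end OffDiagSimple

variable [MeasurableSpace Ω] {P : Measure Ω}

lemma ProbabilityTheory.IsGaussianProcess.hasGaussianLaw_fintype {T ι : Type*} [Fintype ι]
    {X : T → Ω → ℝ} (hX : IsGaussianProcess X P) (t : ι → T) :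
    HasGaussianLaw (fun ω i => X (t i) ω) P := by
  have h := (hX.comp_right t).hasGaussianLaw Finset.univ
  exact h.map_fun (ContinuousLinearMap.pi fun i =>
    ContinuousLinearMap.proj (R := ℝ) (φ := fun _ : (Finset.univ : Finset ι) => ℝ)
      ⟨i, Finset.mem_univ i⟩)

lemma IsBrownianRandomMeasure.hasGaussianLaw (hB : IsBrownianRandomMeasure P B) {ι : Type*}
    [Fintype ι] (S : ι → Set ℝ) (hS : ∀ i, MeasurableSet (S i)) (hS' : ∀ i, volume (S i) < ∞) :
    HasGaussianLaw (fun ω i => B (S i) ω) P :=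
  hB.isGaussianProcess.hasGaussianLaw_fintype fun i => ⟨S i, hS i, hS' i⟩

lemma IsBrownianRandomMeasure.hasAllMoments (hB : IsBrownianRandomMeasure P B) {S : Set ℝ}
    (hS : MeasurableSet S) (hS' : volume S < ∞) : HasAllMoments (B S) P :=
  ((hB.hasGaussianLaw (fun _ : Unit => S) (fun _ => hS) fun _ => hS').eval ()).hasAllMoments

namespace OffDiagSimple

lemma hasAllMoments_integral (hB : IsBrownianRandomMeasure P B) (φ : OffDiagSimple) :
    HasAllMoments (φ.integral B) P :=
  HasAllMoments.sum _ fun i _ => HasAllMoments.sum _ fun j _ =>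
    ((hB.hasAllMoments (φ.measurableSet_sets i) (φ.volume_sets_lt_top i)).mul
      (hB.hasAllMoments (φ.measurableSet_sets j) (φ.volume_sets_lt_top j))).const_mul _

lemma volume_inter_eq_zero (φ : OffDiagSimple) {i j : Fin φ.n} (hij : i ≠ j) :
    volume.real (φ.sets i ∩ φ.sets j) = 0 := by
  rw [(φ.disjoint_sets hij).inter_eq]; simp

/-- Moments of the double integral of an off-diagonal simple function. -/
lemma moments_integral [IsProbabilityMeasure P] (hB : IsBrownianRandomMeasure P B)
    (φ : OffDiagSimple) :
    ∫ ω, φ.integral B ω ∂P = 0 ∧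
    ∫ ω, φ.integral B ω ^ 3 ∂P = 8 * ∑ i, ∑ j, ∑ k,
      φ.symmetrize.coeff i j * φ.symmetrize.coeff j k * φ.symmetrize.coeff k i *
        (volume.real (φ.sets i) * volume.real (φ.sets j) * volume.real (φ.sets k)) ∧
    ∫ ω, φ.integral B ω ^ 4 ∂P ≤ 15 * (∫ ω, φ.integral B ω ^ 2 ∂P) ^ 2 := by
  obtain ⟨-, h1, h2, h3, h4⟩ := moments_quadraticForm_offDiag
    (hB.hasGaussianLaw φ.sets φ.measurableSet_sets φ.volume_sets_lt_top)
    (fun i => hB.mean_eq_zero _ (φ.measurableSet_sets i) (φ.volume_sets_lt_top i))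
    (fun i => volume.real (φ.sets i)) (fun i => measureReal_nonneg)
    (fun i j => by
      rw [hB.covariance_eq _ _ (φ.measurableSet_sets i) (φ.volume_sets_lt_top i)
        (φ.measurableSet_sets j) (φ.volume_sets_lt_top j)]
      split_ifs with h
      · rw [h, Set.inter_self]; rfl
      · exact φ.volume_inter_eq_zero h)
    φ.symmetrize.coeff (fun i j => by simp only [symmetrize]; ring) φ.symmetrize.coeff_diag
  have hQ : (fun ω => φ.integral B ω) = fun ω => ∑ i : Fin φ.n, ∑ j : Fin φ.n,
      φ.symmetrize.coeff i j * (B (φ.sets i) ω * B (φ.sets j) ω) := by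
    conv_lhs => rw [← φ.symmetrize_integral]
    rfl
  have hQ' : ∀ ω, φ.integral B ω = ∑ i : Fin φ.n, ∑ j : Fin φ.n,
      φ.symmetrize.coeff i j * (B (φ.sets i) ω * B (φ.sets j) ω) := congrFun hQ
  simp_rw [hQ']
  exact ⟨h1, h3, by rw [h2]; exact h4⟩

lemma integral_prod_indicator {S S' T T' : Set ℝ} (hS : MeasurableSet S) (hS' : MeasurableSet S')
    (hT : MeasurableSet T) (hT' : MeasurableSet T') :
    ∫ x : ℝ × ℝ, (S.indicator (fun _ => (1 : ℝ)) x.1 * S'.indicator (fun _ => (1 : ℝ)) x.2) *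
      (T.indicator (fun _ => (1 : ℝ)) x.1 * T'.indicator (fun _ => (1 : ℝ)) x.2) =
      volume.real (S ∩ T) * volume.real (S' ∩ T') := by
  have h1 : ∀ x : ℝ × ℝ,
      (S.indicator (fun _ => (1 : ℝ)) x.1 * S'.indicator (fun _ => (1 : ℝ)) x.2) *
      (T.indicator (fun _ => (1 : ℝ)) x.1 * T'.indicator (fun _ => (1 : ℝ)) x.2) =
      (S ∩ T).indicator (fun _ => (1 : ℝ)) x.1 * (S' ∩ T').indicator (fun _ => (1 : ℝ)) x.2 := by
    intro x
    by_cases h1 : x.1 ∈ S <;> by_cases h2 : x.1 ∈ T <;> by_cases h3 : x.2 ∈ S' <;>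
      by_cases h4 : x.2 ∈ T' <;> simp [h1, h2, h3, h4]
  simp_rw [h1, Measure.volume_eq_prod]
  rw [integral_prod_mul (fun x => (S ∩ T).indicator (fun _ => (1 : ℝ)) x)
    fun x => (S' ∩ T').indicator (fun _ => (1 : ℝ)) x, integral_indicator (hS.inter hT),
    integral_indicator (hS'.inter hT')]
  simp

lemma memLp_prod_indicator {S T : Set ℝ} (hS : MeasurableSet S)
    (hT : MeasurableSet T) (hS' : volume S < ∞) (hT' : volume T < ∞) (p : ℝ≥0∞) :
    MemLp (fun x : ℝ × ℝ => S.indicator (fun _ => (1 : ℝ)) x.1 *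
      T.indicator (fun _ => (1 : ℝ)) x.2) p := by
  have : (fun x : ℝ × ℝ => S.indicator (fun _ => (1 : ℝ)) x.1 *
      T.indicator (fun _ => (1 : ℝ)) x.2) = (S ×ˢ T).indicator (fun _ => (1 : ℝ)) := by
    ext x
    by_cases h1 : x.1 ∈ S <;> by_cases h2 : x.2 ∈ T <;> simp [h1, h2]
  rw [this]
  refine memLp_indicator_const p (hS.prod hT) 1 (Or.inr ?_)
  rw [Measure.volume_eq_prod, Measure.prod_prod]
  exact (ENNReal.mul_lt_top hS' hT').ne

lemma memLp_toFun (φ : OffDiagSimple) (p : ℝ≥0∞) : MemLp φ.toFun p :=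
  memLp_finsetSum _ fun i _ => memLp_finsetSum _ fun j _ =>
    (memLp_prod_indicator (φ.measurableSet_sets i) (φ.measurableSet_sets j)
      (φ.volume_sets_lt_top i) (φ.volume_sets_lt_top j) p).const_mul _

lemma toFun_swap (φ : OffDiagSimple) (x : ℝ × ℝ) :
    φ.toFun x.swap = ∑ i, ∑ j, φ.coeff j i *
      ((φ.sets i).indicator (fun _ => (1 : ℝ)) x.1 *
        (φ.sets j).indicator (fun _ => (1 : ℝ)) x.2) := by
  simp only [toFun, Prod.fst_swap, Prod.snd_swap]
  rw [Finset.sum_comm]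
  exact Finset.sum_congr rfl fun i _ => Finset.sum_congr rfl fun j _ => by ring

lemma symmetrize_toFun (φ : OffDiagSimple) (x : ℝ × ℝ) :
    φ.symmetrize.toFun x = (φ.toFun x + φ.toFun x.swap) / 2 := by
  rw [toFun_swap]
  change ∑ i : Fin φ.n, ∑ j : Fin φ.n, (φ.coeff i j + φ.coeff j i) / 2 *
    ((φ.sets i).indicator (fun _ => (1 : ℝ)) x.1 * (φ.sets j).indicator (fun _ => (1 : ℝ)) x.2) =
    (∑ i : Fin φ.n, ∑ j : Fin φ.n, φ.coeff i j *
    ((φ.sets i).indicator (fun _ => (1 : ℝ)) x.1 * (φ.sets j).indicator (fun _ => (1 : ℝ)) x.2) + _)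
      / 2
  rw [← Finset.sum_add_distrib, Finset.sum_div]
  refine Finset.sum_congr rfl fun i _ => ?_
  rw [← Finset.sum_add_distrib, Finset.sum_div]
  exact Finset.sum_congr rfl fun j _ => by ring

lemma memLp_toFun_swap (φ : OffDiagSimple) (p : ℝ≥0∞) : MemLp (fun x : ℝ × ℝ => φ.toFun x.swap) p :=
  (φ.memLp_toFun p).comp_measurePreserving (μ := volume) Measure.measurePreserving_swap

lemma integral_sum_mul_sum {α : Type*} [MeasurableSpace α] {μ : Measure α} {n m : ℕ}
    (a : Fin n → Fin n → ℝ) (b : Fin m → Fin m → ℝ) (u : Fin n → Fin n → α → ℝ)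
    (v : Fin m → Fin m → α → ℝ)
    (huv : ∀ i j k l, Integrable (fun x => u i j x * v k l x) μ) :
    ∫ x, (∑ i, ∑ j, a i j * u i j x) * (∑ k, ∑ l, b k l * v k l x) ∂μ =
      ∑ i, ∑ j, ∑ k, ∑ l, a i j * b k l * ∫ x, u i j x * v k l x ∂μ := by
  have h : ∀ x, (∑ i, ∑ j, a i j * u i j x) * (∑ k, ∑ l, b k l * v k l x) =
      ∑ i, ∑ j, ∑ k, ∑ l, a i j * b k l * (u i j x * v k l x) := by
    intro x
    simp_rw [Finset.sum_mul, Finset.mul_sum]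
    exact Finset.sum_congr rfl fun i _ => Finset.sum_congr rfl fun j _ =>
      Finset.sum_congr rfl fun k _ => Finset.sum_congr rfl fun l _ => by ring
  have h4 := fun i j k l => (huv i j k l).const_mul (a i j * b k l)
  have h3 := fun i j k => integrable_finsetSum (μ := μ) Finset.univ fun l _ => h4 i j k l
  have h2 := fun i j => integrable_finsetSum (μ := μ) Finset.univ fun k _ => h3 i j k
  have h1 := fun i => integrable_finsetSum (μ := μ) Finset.univ fun j _ => h2 i j
  simp_rw [h]
  rw [integral_finsetSum _ fun i _ => h1 i]
  refine Finset.sum_congr rfl fun i _ => ?_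
  rw [integral_finsetSum _ fun j _ => h2 i j]
  refine Finset.sum_congr rfl fun j _ => ?_
  rw [integral_finsetSum _ fun k _ => h3 i j k]
  refine Finset.sum_congr rfl fun k _ => ?_
  rw [integral_finsetSum _ fun l _ => h4 i j k l]
  exact Finset.sum_congr rfl fun l _ => integral_const_mul _ _

/-- The isometry property of the double integral on off-diagonal simple functions. -/
lemma integral_mul_integral [IsProbabilityMeasure P] (hB : IsBrownianRandomMeasure P B)
    (φ ψ : OffDiagSimple) :
    ∫ ω, φ.integral B ω * ψ.integral B ω ∂P =
      (∫ x, φ.toFun x * ψ.toFun x) + ∫ x, φ.toFun x * ψ.toFun x.swap := by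
  have hMφ := fun i => hB.hasAllMoments (φ.measurableSet_sets i) (φ.volume_sets_lt_top i)
  have hMψ := fun i => hB.hasAllMoments (ψ.measurableSet_sets i) (ψ.volume_sets_lt_top i)
  have hφ := fun i j => memLp_prod_indicator (φ.measurableSet_sets i)
    (φ.measurableSet_sets j) (φ.volume_sets_lt_top i) (φ.volume_sets_lt_top j) 2
  have hψ := fun i j => memLp_prod_indicator (ψ.measurableSet_sets i)
    (ψ.measurableSet_sets j) (ψ.volume_sets_lt_top i) (ψ.volume_sets_lt_top j) 2
  have hint := fun i j k l => (hφ i j).integrable_mul (hψ k l)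
  have e1 : ∫ x, φ.toFun x * ψ.toFun x = ∑ i, ∑ j, ∑ k, ∑ l, φ.coeff i j * ψ.coeff k l *
      (volume.real (φ.sets i ∩ ψ.sets k) * volume.real (φ.sets j ∩ ψ.sets l)) := by
    refine (integral_sum_mul_sum φ.coeff ψ.coeff _ _ hint).trans ?_
    simp_rw [integral_prod_indicator (φ.measurableSet_sets _) (φ.measurableSet_sets _)
      (ψ.measurableSet_sets _) (ψ.measurableSet_sets _)]
  have e2 : ∫ x, φ.toFun x * ψ.toFun x.swap = ∑ i, ∑ j, ∑ k, ∑ l, φ.coeff i j * ψ.coeff l k *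
      (volume.real (φ.sets i ∩ ψ.sets k) * volume.real (φ.sets j ∩ ψ.sets l)) := by
    simp_rw [toFun_swap]
    refine (integral_sum_mul_sum φ.coeff (fun k l => ψ.coeff l k) _ _ hint).trans ?_
    simp_rw [integral_prod_indicator (φ.measurableSet_sets _) (φ.measurableSet_sets _)
      (ψ.measurableSet_sets _) (ψ.measurableSet_sets _)]
  rw [e1, e2]
  simp only [integral]
  rw [integral_sum_mul_sum _ _ _ _ fun i j k l =>
      (((hMφ i).mul (hMφ j)).mul ((hMψ k).mul (hMψ l))).integrable]
  have hs : ∀ i j, ∑ k, ∑ l, φ.coeff i j * ψ.coeff l k *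
      (volume.real (φ.sets i ∩ ψ.sets k) * volume.real (φ.sets j ∩ ψ.sets l)) =
      ∑ k, ∑ l, φ.coeff i j * ψ.coeff k l *
      (volume.real (φ.sets i ∩ ψ.sets l) * volume.real (φ.sets j ∩ ψ.sets k)) :=
    fun i j => Finset.sum_comm
  simp_rw [hs, ← Finset.sum_add_distrib]
  refine Finset.sum_congr rfl fun i _ => Finset.sum_congr rfl fun j _ =>
    Finset.sum_congr rfl fun k _ => Finset.sum_congr rfl fun l _ => ?_
  rw [← mul_add]
  rcases eq_or_ne i j with rfl | hij
  · simp [φ.coeff_diag]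
  congr 1
  have hS : ∀ a, MeasurableSet (![φ.sets i, φ.sets j, ψ.sets k, ψ.sets l] a) := by
    intro a
    fin_cases a
    exacts [φ.measurableSet_sets i, φ.measurableSet_sets j, ψ.measurableSet_sets k,
      ψ.measurableSet_sets l]
  have hS' : ∀ a, volume (![φ.sets i, φ.sets j, ψ.sets k, ψ.sets l] a) < ∞ := by
    intro a
    fin_cases a
    exacts [φ.volume_sets_lt_top i, φ.volume_sets_lt_top j, ψ.volume_sets_lt_top k,
      ψ.volume_sets_lt_top l]
  have hW := integral_mul_four_of_hasGaussianLaw (hB.hasGaussianLaw _ hS hS')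
    fun a => hB.mean_eq_zero _ (hS a) (hS' a)
  have hc := fun a b => hB.covariance_eq _ _ (hS a) (hS' a) (hS b) (hS' b)
  rw [hc 0 1, hc 2 3, hc 0 2, hc 1 3, hc 0 3, hc 1 2] at hW
  simp only [Matrix.cons_val] at hW
  have h0 := φ.volume_inter_eq_zero hij
  simp only [Measure.real] at h0 ⊢
  rw [h0, zero_mul, zero_add] at hW
  rw [← hW]
  exact integral_congr_ae (ae_of_all _ fun ω => by ring)

end OffDiagSimple

end SimpleIntegrals

section LpLimits

variable {α : Type*} [MeasurableSpace α] {μ : Measure α}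

lemma tendsto_eLpNorm_of_tendsto_sub {p : ℝ≥0∞} (hp : 1 ≤ p) {f : ℕ → α → ℝ} {g : α → ℝ}
    (hf : ∀ k, MemLp (f k) p μ) (hg : MemLp g p μ)
    (h : Tendsto (fun k => eLpNorm (f k - g) p μ) atTop (𝓝 0)) :
    Tendsto (fun k => eLpNorm (f k) p μ) atTop (𝓝 (eLpNorm g p μ)) := by
  have h1 : Tendsto (fun k => eLpNorm g p μ - eLpNorm (f k - g) p μ) atTop
      (𝓝 (eLpNorm g p μ)) := by
    simpa using ENNReal.Tendsto.sub tendsto_const_nhds h (Or.inr ENNReal.zero_ne_top)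
  have h2 : Tendsto (fun k => eLpNorm (f k - g) p μ + eLpNorm g p μ) atTop
      (𝓝 (eLpNorm g p μ)) := by
    simpa using h.add_const (eLpNorm g p μ)
  refine tendsto_of_tendsto_of_tendsto_of_le_of_le h1 h2 (fun k => ?_) fun k => ?_
  · rw [tsub_le_iff_left]
    have := eLpNorm_add_le ((hg.sub (hf k)).1) (hf k).1 hp
    rwa [sub_add_cancel, eLpNorm_sub_comm] at this
  · have := eLpNorm_add_le (((hf k).sub hg).1) hg.1 hp
    rwa [sub_add_cancel] at this

lemma abs_integral_mul_le {f g : α → ℝ} (hf : MemLp f 2 μ) (hg : MemLp g 2 μ) :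
    |∫ x, f x * g x ∂μ| ≤ (eLpNorm f 2 μ * eLpNorm g 2 μ).toReal := by
  rw [← Real.norm_eq_abs, ← toReal_enorm]
  refine ENNReal.toReal_mono (ENNReal.mul_lt_top hf.2 hg.2).ne ?_
  refine (enorm_integral_le_lintegral_enorm _).trans ?_
  have := eLpNorm_smul_le_mul_eLpNorm (p := 2) (q := 2) (r := 1) hg.1 hf.1
  rw [eLpNorm_one_eq_lintegral_enorm] at this
  exact this

lemma tendsto_integral_mul {f f' : ℕ → α → ℝ} {g g' : α → ℝ} (hf : ∀ k, MemLp (f k) 2 μ)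
    (hf' : ∀ k, MemLp (f' k) 2 μ) (hg : MemLp g 2 μ) (hg' : MemLp g' 2 μ)
    (h : Tendsto (fun k => eLpNorm (f k - g) 2 μ) atTop (𝓝 0))
    (h' : Tendsto (fun k => eLpNorm (f' k - g') 2 μ) atTop (𝓝 0)) :
    Tendsto (fun k => ∫ x, f k x * f' k x ∂μ) atTop (𝓝 (∫ x, g x * g' x ∂μ)) := by
  have hn := tendsto_eLpNorm_of_tendsto_sub one_le_two hf' hg' h'
  rw [tendsto_iff_norm_sub_tendsto_zero]
  have hb : Tendsto (fun k => eLpNorm (f k - g) 2 μ * eLpNorm (f' k) 2 μ +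
      eLpNorm g 2 μ * eLpNorm (f' k - g') 2 μ) atTop (𝓝 0) := by
    have a1 := ENNReal.Tendsto.mul h (Or.inr hg'.2.ne) hn (Or.inr ENNReal.zero_ne_top)
    have a2 := ENNReal.Tendsto.const_mul h' (Or.inr hg.2.ne)
    simpa using a1.add a2
  have hb' := (ENNReal.tendsto_toReal ENNReal.zero_ne_top).comp hb
  refine squeeze_zero (fun _ => norm_nonneg _) (fun k => ?_) hb'
  have t1 := ((hf k).sub hg).2.ne
  have t2 := (hf' k).2.ne
  have t3 := hg.2.ne
  have t4 := ((hf' k).sub hg').2.ne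
  have e : (∫ x, f k x * f' k x ∂μ) - ∫ x, g x * g' x ∂μ =
      (∫ x, (f k - g) x * f' k x ∂μ) + ∫ x, g x * (f' k - g') x ∂μ := by
    have i1 : Integrable (fun x => f k x * f' k x) μ := (hf k).integrable_mul (hf' k)
    have i2 : Integrable (fun x => g x * g' x) μ := hg.integrable_mul hg'
    have i3 : Integrable (fun x => (f k - g) x * f' k x) μ :=
      ((hf k).sub hg).integrable_mul (hf' k)
    have i4 : Integrable (fun x => g x * (f' k - g') x) μ := hg.integrable_mul ((hf' k).sub hg')
    rw [← integral_sub i1 i2, ← integral_add i3 i4]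
    refine integral_congr_ae (ae_of_all _ fun x => ?_)
    simp only [Pi.sub_apply]
    ring
  rw [e, Function.comp_apply, ENNReal.toReal_add (ENNReal.mul_ne_top t1 t2)
    (ENNReal.mul_ne_top t3 t4), Real.norm_eq_abs]
  refine (abs_add_le _ _).trans (add_le_add ?_ ?_)
  · exact abs_integral_mul_le ((hf k).sub hg) (hf' k)
  · exact abs_integral_mul_le hg ((hf' k).sub hg')

end LpLimits

section CyclicForm

lemma quasiMeasurePreserving_fst_fst_snd :
    Measure.QuasiMeasurePreserving (fun p : ℝ × ℝ × ℝ => (p.1, p.2.1)) volume volume :=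
  Measure.quasiMeasurePreserving_fst.comp
    (volume_preserving_prodAssoc.symm (α := (ℝ × ℝ) × ℝ) (β := ℝ × ℝ × ℝ)
      MeasurableEquiv.prodAssoc).quasiMeasurePreserving

lemma quasiMeasurePreserving_snd_snd_fst :
    Measure.QuasiMeasurePreserving (fun p : ℝ × ℝ × ℝ => (p.2.2, p.1)) volume volume :=
  Measure.quasiMeasurePreserving_snd.comp
    ((volume_preserving_prodAssoc (α₁ := ℝ) (β₁ := ℝ) (γ₁ := ℝ)).comp
      Measure.measurePreserving_swap).quasiMeasurePreserving

lemma quasiMeasurePreserving_snd_real :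
    Measure.QuasiMeasurePreserving (fun p : ℝ × ℝ × ℝ => p.2) volume volume :=
  Measure.quasiMeasurePreserving_snd

lemma lintegral_cyclic_le_of_measurable {u v w : ℝ × ℝ → ℝ≥0∞} (hu : Measurable u)
    (hv : Measurable v) (hw : Measurable w) :
    ∫⁻ p : ℝ × ℝ × ℝ, u (p.1, p.2.1) * v p.2 * w (p.2.2, p.1) ≤
      (∫⁻ x, u x ^ (2 : ℝ)) ^ (1 / 2 : ℝ) * (∫⁻ x, v x ^ (2 : ℝ)) ^ (1 / 2 : ℝ) *
        (∫⁻ x, w x ^ (2 : ℝ)) ^ (1 / 2 : ℝ) := by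
  have hpq : Real.HolderConjugate 2 2 := Real.HolderConjugate.two_two
  set F : ℝ → ℝ≥0∞ := fun x => ∫⁻ y, u (x, y) ^ (2 : ℝ) with hF
  set H : ℝ → ℝ≥0∞ := fun x => ∫⁻ z, w (z, x) ^ (2 : ℝ) with hH
  have hFm : Measurable F := by fun_prop
  have hHm : Measurable H := by
    have : Measurable fun p : ℝ × ℝ => w (p.2, p.1) ^ (2 : ℝ) := by fun_prop
    exact this.lintegral_prod_right'
  rw [Measure.volume_eq_prod, lintegral_prod _ (by fun_prop)]
  have step : ∀ x, ∫⁻ q : ℝ × ℝ, u (x, q.1) * v q * w (q.2, x) ≤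
      (∫⁻ q, v q ^ (2 : ℝ)) ^ (1 / 2 : ℝ) * (F x ^ (1 / 2 : ℝ) * H x ^ (1 / 2 : ℝ)) := by
    intro x
    have h1 := ENNReal.lintegral_mul_le_Lp_mul_Lq (volume : Measure (ℝ × ℝ)) hpq (f := v)
      (g := fun q => u (x, q.1) * w (q.2, x)) (by fun_prop) (by fun_prop)
    have h2 : ∫⁻ q : ℝ × ℝ, (u (x, q.1) * w (q.2, x)) ^ (2 : ℝ) = F x * H x := by
      simp_rw [ENNReal.mul_rpow_of_nonneg _ _ (zero_le_two (α := ℝ))]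
      rw [Measure.volume_eq_prod]
      exact lintegral_prod_mul (f := fun y => u (x, y) ^ (2 : ℝ))
        (g := fun z => w (z, x) ^ (2 : ℝ)) (by fun_prop) (by fun_prop)
    rw [h2, ENNReal.mul_rpow_of_nonneg _ _ (by norm_num)] at h1
    refine le_trans (le_of_eq (lintegral_congr fun q => ?_)) h1
    simp only [Pi.mul_apply]
    ring
  have hFH : ∫⁻ x, F x ^ (1 / 2 : ℝ) * H x ^ (1 / 2 : ℝ) ≤
      (∫⁻ x, F x) ^ (1 / 2 : ℝ) * (∫⁻ x, H x) ^ (1 / 2 : ℝ) := by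
    have h1 := ENNReal.lintegral_mul_le_Lp_mul_Lq (volume : Measure ℝ) hpq
      (f := fun x => F x ^ (1 / 2 : ℝ)) (g := fun x => H x ^ (1 / 2 : ℝ)) (by fun_prop)
      (by fun_prop)
    simp_rw [← ENNReal.rpow_mul] at h1
    norm_num at h1 ⊢
    exact h1
  have hFu : ∫⁻ x, F x = ∫⁻ x, u x ^ (2 : ℝ) := by
    rw [Measure.volume_eq_prod, lintegral_prod _ (by fun_prop)]
  have hHw : ∫⁻ x, H x = ∫⁻ x, w x ^ (2 : ℝ) := by
    rw [Measure.volume_eq_prod, lintegral_prod_symm _ (by fun_prop)]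
  calc _ ≤ ∫⁻ x, (∫⁻ q, v q ^ (2 : ℝ)) ^ (1 / 2 : ℝ) * (F x ^ (1 / 2 : ℝ) * H x ^ (1 / 2 : ℝ)) :=
        lintegral_mono step
    _ = (∫⁻ q, v q ^ (2 : ℝ)) ^ (1 / 2 : ℝ) * ∫⁻ x, F x ^ (1 / 2 : ℝ) * H x ^ (1 / 2 : ℝ) :=
        lintegral_const_mul _ (by fun_prop)
    _ ≤ (∫⁻ q, v q ^ (2 : ℝ)) ^ (1 / 2 : ℝ) *
        ((∫⁻ x, F x) ^ (1 / 2 : ℝ) * (∫⁻ x, H x) ^ (1 / 2 : ℝ)) := by gcongr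
    _ = _ := by rw [hFu, hHw]; simp only [Measure.volume_eq_prod]; ring

lemma lintegral_cyclic_le {f g h : ℝ × ℝ → ℝ} (hf : AEStronglyMeasurable f)
    (hg : AEStronglyMeasurable g) (hh : AEStronglyMeasurable h) :
    ∫⁻ p : ℝ × ℝ × ℝ, ‖f (p.1, p.2.1) * g p.2 * h (p.2.2, p.1)‖ₑ ≤
      eLpNorm f 2 volume * eLpNorm g 2 volume * eLpNorm h 2 volume := by
  have h1 := quasiMeasurePreserving_fst_fst_snd.ae hf.ae_eq_mk
  have h2 := quasiMeasurePreserving_snd_real.ae hg.ae_eq_mk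
  have h3 := quasiMeasurePreserving_snd_snd_fst.ae hh.ae_eq_mk
  rw [eLpNorm_congr_ae hf.ae_eq_mk, eLpNorm_congr_ae hg.ae_eq_mk, eLpNorm_congr_ae hh.ae_eq_mk]
  simp_rw [eLpNorm_eq_lintegral_rpow_enorm_toReal (two_ne_zero (α := ℝ≥0∞)) ENNReal.ofNat_ne_top]
  simp only [ENNReal.toReal_ofNat]
  refine le_trans (le_of_eq (lintegral_congr_ae ?_))
    (lintegral_cyclic_le_of_measurable (u := fun x => ‖hf.mk f x‖ₑ) (v := fun x => ‖hg.mk g x‖ₑ)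
      (w := fun x => ‖hh.mk h x‖ₑ) hf.stronglyMeasurable_mk.measurable.enorm
      hg.stronglyMeasurable_mk.measurable.enorm hh.stronglyMeasurable_mk.measurable.enorm)
  filter_upwards [h1, h2, h3] with p h1 h2 h3
  rw [h1, h2, h3, enorm_mul, enorm_mul]

/-- The trilinear form `∫∫∫ f(x, y) g(y, z) h(z, x)`. -/
def cyclicForm (f g h : ℝ × ℝ → ℝ) : ℝ :=
  ∫ p : ℝ × ℝ × ℝ, f (p.1, p.2.1) * g p.2 * h (p.2.2, p.1)

lemma integrable_cyclic {f g h : ℝ × ℝ → ℝ} (hf : MemLp f 2) (hg : MemLp g 2) (hh : MemLp h 2) :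
    Integrable fun p : ℝ × ℝ × ℝ => f (p.1, p.2.1) * g p.2 * h (p.2.2, p.1) := by
  refine ⟨((hf.1.comp_quasiMeasurePreserving quasiMeasurePreserving_fst_fst_snd).mul
    (hg.1.comp_quasiMeasurePreserving quasiMeasurePreserving_snd_real)).mul
    (hh.1.comp_quasiMeasurePreserving quasiMeasurePreserving_snd_snd_fst), ?_⟩
  exact (lintegral_cyclic_le hf.1 hg.1 hh.1).trans_lt
    (ENNReal.mul_lt_top (ENNReal.mul_lt_top hf.2 hg.2) hh.2)

lemma abs_cyclicForm_le {f g h : ℝ × ℝ → ℝ} (hf : MemLp f 2) (hg : MemLp g 2) (hh : MemLp h 2) :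
    |cyclicForm f g h| ≤ (eLpNorm f 2 volume * eLpNorm g 2 volume * eLpNorm h 2 volume).toReal := by
  rw [← Real.norm_eq_abs, ← toReal_enorm]
  refine ENNReal.toReal_mono
    (ENNReal.mul_lt_top (ENNReal.mul_lt_top hf.2 hg.2) hh.2).ne ?_
  exact (enorm_integral_le_lintegral_enorm _).trans (lintegral_cyclic_le hf.1 hg.1 hh.1)

lemma cyclicForm_sub_eq {f g : ℝ × ℝ → ℝ} (hf : MemLp f 2) (hg : MemLp g 2) :
    cyclicForm f f f - cyclicForm g g g =
      cyclicForm (f - g) f f + cyclicForm g (f - g) f + cyclicForm g g (f - g) := by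
  have i1 := integrable_cyclic (hf.sub hg) hf hf
  have i2 := integrable_cyclic hg (hf.sub hg) hf
  have i3 := integrable_cyclic hg hg (hf.sub hg)
  unfold cyclicForm
  rw [← integral_sub (integrable_cyclic hf hf hf) (integrable_cyclic hg hg hg),
    ← integral_add i1 i2]
  refine Eq.trans ?_ (integral_add (i1.add i2) i3)
  refine integral_congr_ae (ae_of_all _ fun p => ?_)
  simp only [Pi.sub_apply]
  ring

lemma tendsto_cyclicForm {f : ℕ → ℝ × ℝ → ℝ} {g : ℝ × ℝ → ℝ} (hf : ∀ k, MemLp (f k) 2)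
    (hg : MemLp g 2) (h : Tendsto (fun k => eLpNorm (f k - g) 2 volume) atTop (𝓝 0)) :
    Tendsto (fun k => cyclicForm (f k) (f k) (f k)) atTop (𝓝 (cyclicForm g g g)) := by
  have hn : Tendsto (fun k => eLpNorm (f k) 2 volume) atTop (𝓝 (eLpNorm g 2 volume)) :=
    tendsto_eLpNorm_of_tendsto_sub one_le_two hf hg h
  set d := fun k => eLpNorm (f k - g) 2 volume
  set N := fun k => eLpNorm (f k) 2 volume
  set M := eLpNorm g 2 volume
  rw [tendsto_iff_norm_sub_tendsto_zero]
  have hb : Tendsto (fun k => d k * N k * N k + M * d k * N k + M * M * d k) atTop (𝓝 0) := by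
    have hM : M ≠ ∞ := hg.2.ne
    have a1 := ENNReal.Tendsto.mul h (Or.inr hM) hn (Or.inr ENNReal.zero_ne_top)
    have a2 := ENNReal.Tendsto.mul a1 (Or.inr hM) hn (Or.inr (by simp))
    have a3 := ENNReal.Tendsto.mul (ENNReal.Tendsto.const_mul h (Or.inr hM)) (Or.inr hM) hn
      (Or.inr (by simp))
    have a4 := ENNReal.Tendsto.const_mul (a := M * M) h (Or.inr (ENNReal.mul_ne_top hM hM))
    simpa using (a2.add a3).add a4
  have hb' := (ENNReal.tendsto_toReal ENNReal.zero_ne_top).comp hb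
  refine squeeze_zero (fun _ => norm_nonneg _) (fun k => ?_) hb'
  have hd : MemLp (f k - g) 2 := (hf k).sub hg
  have t1 : d k ≠ ∞ := hd.2.ne
  have t2 : N k ≠ ∞ := (hf k).2.ne
  have t3 : M ≠ ∞ := hg.2.ne
  rw [cyclicForm_sub_eq (hf k) hg, Function.comp_apply, ENNReal.toReal_add, ENNReal.toReal_add,
    Real.norm_eq_abs]
  · refine (abs_add_three _ _ _).trans ?_
    gcongr
    · exact abs_cyclicForm_le hd (hf k) (hf k)
    · exact abs_cyclicForm_le hg hd (hf k)
    · exact abs_cyclicForm_le hg hg hd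
  all_goals finiteness

namespace OffDiagSimple

lemma cyclic_toFun_eq (φ : OffDiagSimple) (x y z : ℝ) :
    φ.toFun (x, y) * φ.toFun (y, z) * φ.toFun (z, x) =
      ∑ i, ∑ j, ∑ k, φ.coeff i j * φ.coeff j k * φ.coeff k i *
        ((φ.sets i).indicator (fun _ => (1 : ℝ)) x * ((φ.sets j).indicator (fun _ => (1 : ℝ)) y *
          (φ.sets k).indicator (fun _ => (1 : ℝ)) z)) := by
  have key : ∀ t, (∀ i, (φ.sets i).indicator (fun _ => (1 : ℝ)) t = 0) ∨
      ∃ a, ∀ i, (φ.sets i).indicator (fun _ => (1 : ℝ)) t = if i = a then 1 else 0 := by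
    intro t
    by_cases h : ∃ a, t ∈ φ.sets a
    · obtain ⟨a, ha⟩ := h
      refine Or.inr ⟨a, fun i => ?_⟩
      split_ifs with hi
      · subst hi; simp [ha]
      · exact Set.indicator_of_notMem (fun hti =>
          Set.disjoint_left.1 (φ.disjoint_sets hi) hti ha) _
    · push Not at h
      exact Or.inl fun i => Set.indicator_of_notMem (h i) _
  simp only [toFun]
  rcases key x with hx | ⟨a, hx⟩
  · simp [hx]
  rcases key y with hy | ⟨b, hy⟩
  · simp [hy]
  rcases key z with hz | ⟨c, hz⟩
  · simp [hz]
  simp [hx, hy, hz]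

lemma cyclicForm_toFun (φ : OffDiagSimple) :
    cyclicForm φ.toFun φ.toFun φ.toFun = ∑ i, ∑ j, ∑ k,
      φ.coeff i j * φ.coeff j k * φ.coeff k i *
        (volume.real (φ.sets i) * volume.real (φ.sets j) * volume.real (φ.sets k)) := by
  unfold cyclicForm
  have hi : ∀ i, Integrable ((φ.sets i).indicator (fun _ => (1 : ℝ))) volume := fun i =>
    (integrable_indicator_iff (φ.measurableSet_sets i)).2
      (integrableOn_const (φ.volume_sets_lt_top i).ne)
  have hv : ∀ i, ∫ x, (φ.sets i).indicator (fun _ => (1 : ℝ)) x = volume.real (φ.sets i) := by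
    intro i
    rw [integral_indicator (φ.measurableSet_sets i)]; simp
  have h3 := fun i j k => ((hi i).mul_prod ((hi j).mul_prod (hi k))).const_mul
    (φ.coeff i j * φ.coeff j k * φ.coeff k i)
  simp_rw [fun p : ℝ × ℝ × ℝ => φ.cyclic_toFun_eq p.1 p.2.1 p.2.2]
  rw [Measure.volume_eq_prod, Measure.volume_eq_prod]
  rw [integral_finsetSum _ fun i _ => integrable_finsetSum _ fun j _ =>
    integrable_finsetSum _ fun k _ => h3 i j k]
  refine Finset.sum_congr rfl fun i _ => ?_
  rw [integral_finsetSum _ fun j _ => integrable_finsetSum _ fun k _ => h3 i j k]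
  refine Finset.sum_congr rfl fun j _ => ?_
  rw [integral_finsetSum _ fun k _ => h3 i j k]
  refine Finset.sum_congr rfl fun k _ => ?_
  rw [integral_const_mul, integral_prod_mul (fun x => (φ.sets i).indicator (fun _ => (1 : ℝ)) x)
    fun q : ℝ × ℝ => (φ.sets j).indicator (fun _ => (1 : ℝ)) q.1 *
      (φ.sets k).indicator (fun _ => (1 : ℝ)) q.2,
    integral_prod_mul (fun x => (φ.sets j).indicator (fun _ => (1 : ℝ)) x)
    (fun x => (φ.sets k).indicator (fun _ => (1 : ℝ)) x), hv, hv, hv]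
  ring

/-- The third moment of the double integral of an off-diagonal simple function. -/
lemma integral_integral_pow_three {Ω : Type*} [MeasurableSpace Ω] {P : Measure Ω}
    {B : Set ℝ → Ω → ℝ} [IsProbabilityMeasure P] (hB : IsBrownianRandomMeasure P B)
    (φ : OffDiagSimple) :
    ∫ ω, φ.integral B ω ^ 3 ∂P =
      8 * cyclicForm φ.symmetrize.toFun φ.symmetrize.toFun φ.symmetrize.toFun := by
  rw [(φ.moments_integral hB).2.1, cyclicForm_toFun]
  rfl

end OffDiagSimple

end CyclicForm

section ThirdMomentLimit

variable {Ω : Type*} [MeasurableSpace Ω] {P : Measure Ω}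

lemma memLp_four_of_tendsto {Q : ℕ → Ω → ℝ} {X : Ω → ℝ}
    (hQ : ∀ k, HasAllMoments (Q k) P) (hX : AEStronglyMeasurable X P) {C : ℝ}
    (hC : ∀ k, ∫ ω, Q k ω ^ 4 ∂P ≤ C)
    (h : Tendsto (fun k => eLpNorm (Q k - X) 2 P) atTop (𝓝 0)) :
    (∀ k, eLpNorm (Q k) 4 P ≤ ENNReal.ofReal (C ^ (1 / 4 : ℝ))) ∧
      eLpNorm X 4 P ≤ ENNReal.ofReal (C ^ (1 / 4 : ℝ)) := by
  have hb : ∀ k, eLpNorm (Q k) 4 P ≤ ENNReal.ofReal (C ^ (1 / 4 : ℝ)) := by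
    intro k
    rw [(hQ k 4 (by simp)).eLpNorm_eq_integral_rpow_norm (by simp) (by simp)]
    refine ENNReal.ofReal_le_ofReal ?_
    have e : ∀ ω, ‖Q k ω‖ ^ (ENNReal.toReal 4) = Q k ω ^ 4 := by
      intro ω
      rw [ENNReal.toReal_ofNat, Real.rpow_ofNat, Real.norm_eq_abs, (by decide : Even 4).pow_abs]
    simp_rw [e, ENNReal.toReal_ofNat, one_div]
    exact Real.rpow_le_rpow (integral_nonneg fun ω => (by decide : Even 4).pow_nonneg _) (hC k)
      (by norm_num)
  refine ⟨hb, ?_⟩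
  have hQm : ∀ k, AEStronglyMeasurable (Q k) P := fun k => (hQ k).integrable.1
  obtain ⟨ns, -, hns⟩ :=
    (tendstoInMeasure_of_tendsto_eLpNorm two_ne_zero hQm hX h).exists_seq_tendsto_ae
  exact Lp.eLpNorm_le_of_ae_tendsto (Eventually.of_forall fun k => hb (ns k))
    (fun k => hQm (ns k)) hns

lemma tendsto_integral_pow_three {Q : ℕ → Ω → ℝ} {X : Ω → ℝ} {C : ℝ≥0∞} (hCt : C ≠ ∞)
    (hQ : ∀ k, MemLp (Q k) 4 P) (hX : MemLp X 4 P) (hQ2 : ∀ k, MemLp (Q k) 2 P)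
    (hX2 : MemLp X 2 P) (hC : ∀ k, eLpNorm (Q k) 4 P ≤ C) (hC' : eLpNorm X 4 P ≤ C)
    (h : Tendsto (fun k => eLpNorm (Q k - X) 2 P) atTop (𝓝 0)) :
    Tendsto (fun k => ∫ ω, Q k ω ^ 3 ∂P) atTop (𝓝 (∫ ω, X ω ^ 3 ∂P)) := by
  have : ENNReal.HolderTriple 4 4 2 := ⟨by
    rw [← two_mul, show (4 : ℝ≥0∞) = 2 * 2 by norm_num, ENNReal.mul_inv (by simp) (by simp),
      ← mul_assoc, ENNReal.mul_inv_cancel (by simp) (by simp), one_mul]⟩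
  have hmul : ∀ {f g : Ω → ℝ}, MemLp f 4 P → MemLp g 4 P → MemLp (fun ω => f ω * g ω) 2 P :=
    fun hf hg => hg.mul' hf
  have hmul' : ∀ {f g : Ω → ℝ}, MemLp f 4 P → MemLp g 4 P → eLpNorm f 4 P ≤ C →
      eLpNorm g 4 P ≤ C → eLpNorm (fun ω => f ω * g ω) 2 P ≤ C * C := fun hf hg h1 h2 =>
    (eLpNorm_smul_le_mul_eLpNorm (p := 4) (q := 4) (r := 2) hg.1 hf.1).trans (mul_le_mul' h1 h2)
  have hint : ∀ {f : Ω → ℝ}, MemLp f 4 P → MemLp f 2 P → Integrable (fun ω => f ω ^ 3) P := by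
    intro f hf hf2
    have : Integrable (fun ω => f ω * (f ω * f ω)) P := hf2.integrable_mul (hmul hf hf)
    exact this.congr (ae_of_all _ fun ω => by ring)
  rw [tendsto_iff_norm_sub_tendsto_zero]
  have hb : Tendsto (fun k => eLpNorm (Q k - X) 2 P * (C * C + C * C + C * C)) atTop (𝓝 0) := by
    have := ENNReal.Tendsto.mul_const (b := C * C + C * C + C * C) h (Or.inr (by finiteness))
    simpa using this
  have hb' := (ENNReal.tendsto_toReal ENNReal.zero_ne_top).comp hb
  refine squeeze_zero (fun _ => norm_nonneg _) (fun k => ?_) hb'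
  have hW := ((hmul (hQ k) (hQ k)).add (hmul (hQ k) hX)).add (hmul hX hX)
  rw [Real.norm_eq_abs, ← integral_sub (hint (hQ k) (hQ2 k)) (hint hX hX2)]
  have e : ∫ ω, Q k ω ^ 3 - X ω ^ 3 ∂P = ∫ ω, (Q k - X) ω * ((((fun ω => Q k ω * Q k ω) +
      fun ω => Q k ω * X ω) + fun ω => X ω * X ω) ω) ∂P :=
    integral_congr_ae (ae_of_all _ fun ω => by simp only [Pi.sub_apply, Pi.add_apply]; ring)
  rw [e]
  have hd := (hQ2 k).sub hX2
  refine (abs_integral_mul_le hd hW).trans ?_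
  refine ENNReal.toReal_mono (ENNReal.mul_ne_top hd.2.ne (by finiteness)) (mul_le_mul' le_rfl ?_)
  refine (eLpNorm_add_le (hmul (hQ k) (hQ k) |>.add (hmul (hQ k) hX)).1 (hmul hX hX).1
    one_le_two).trans (add_le_add ((eLpNorm_add_le (hmul (hQ k) (hQ k)).1 (hmul (hQ k) hX).1
    one_le_two).trans (add_le_add ?_ ?_)) ?_)
  · exact hmul' (hQ k) (hQ k) (hC k) (hC k)
  · exact hmul' (hQ k) hX (hC k) hC'
  · exact hmul' hX hX hC' hC'

end ThirdMomentLimit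

section DoubleIntegralMoments

variable {Ω : Type*} [MeasurableSpace Ω] {P : Measure Ω} {B : Set ℝ → Ω → ℝ}

lemma tendsto_symmetrize {φ : ℕ → OffDiagSimple} {f : ℝ × ℝ → ℝ} (hf : MemLp f 2 volume)
    (hsym : ∀ x, f x.swap = f x)
    (h : Tendsto (fun k => eLpNorm ((φ k).toFun - f) 2 volume) atTop (𝓝 0)) :
    Tendsto (fun k => eLpNorm (fun x => (φ k).toFun x.swap - f x) 2 volume) atTop (𝓝 0) ∧
    Tendsto (fun k => eLpNorm ((φ k).symmetrize.toFun - f) 2 volume) atTop (𝓝 0) := by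
  have h1 : ∀ k, eLpNorm (fun x => (φ k).toFun x.swap - f x) 2 volume =
      eLpNorm ((φ k).toFun - f) 2 volume := by
    intro k
    have := eLpNorm_comp_measurePreserving (p := 2) (((φ k).memLp_toFun 2).sub hf).1
      (Measure.measurePreserving_swap (μ := (volume : Measure ℝ)) (ν := (volume : Measure ℝ)))
    rw [← Measure.volume_eq_prod] at this
    rw [← this]
    refine congrArg (fun u => eLpNorm u 2 volume) (funext fun x => ?_)
    simp [hsym]
  refine ⟨by simpa only [h1] using h, ?_⟩
  refine tendsto_of_tendsto_of_tendsto_of_le_of_le tendsto_const_nhds h (fun _ => zero_le)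
    fun k => ?_
  have e : (φ k).symmetrize.toFun - f = (1 / 2 : ℝ) • (((φ k).toFun - f) +
      fun x => (φ k).toFun x.swap - f x) := by
    ext x
    simp only [Pi.sub_apply, Pi.smul_apply, Pi.add_apply, OffDiagSimple.symmetrize_toFun,
      smul_eq_mul]
    ring
  rw [e, eLpNorm_const_smul]
  calc _ ≤ ‖(1 / 2 : ℝ)‖ₑ * (eLpNorm ((φ k).toFun - f) 2 volume +
        eLpNorm (fun x => (φ k).toFun x.swap - f x) 2 volume) := by
        gcongr
        exact eLpNorm_add_le (((φ k).memLp_toFun 2).sub hf).1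
          (((φ k).memLp_toFun_swap 2).sub hf).1 one_le_two
    _ = _ := by
        rw [h1, ← two_mul, ← mul_assoc, show (2 : ℝ≥0∞) = ‖(2 : ℝ)‖ₑ by
          rw [Real.enorm_eq_ofReal (by norm_num)]; simp, ← enorm_mul]
        norm_num

/-- The first three moments of the double Wiener–Itô integral of a symmetric kernel. -/
theorem moments_of_isDoubleWienerIto [IsProbabilityMeasure P]
    (hB : IsBrownianRandomMeasure P B) {f : ℝ × ℝ → ℝ} {X : Ω → ℝ} (hsym : ∀ x, f x.swap = f x)
    (h : IsDoubleWienerIto P B f X) :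
    MemLp X 4 P ∧ ∫ ω, X ω ∂P = 0 ∧ ∫ ω, X ω ^ 2 ∂P = 2 * ∫ x, f x ^ 2 ∧
      ∫ ω, X ω ^ 3 ∂P = 8 * cyclicForm f f f := by
  obtain ⟨hf, hX, φ, hφ, hQ⟩ := h
  obtain ⟨hsw, hsy⟩ := tendsto_symmetrize hf hsym hφ
  have hM := fun k => (φ k).hasAllMoments_integral hB
  have hQ2 : ∀ k, MemLp ((φ k).integral B) 2 P := fun k => hM k 2 (by simp)
  have hφ2 := fun k => (φ k).memLp_toFun 2
  have m1 : ∫ ω, X ω ∂P = 0 := by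
    have := tendsto_integral_mul hQ2 (fun _ => memLp_const 1) hX
      (memLp_const (1 : ℝ)) hQ (by simp)
    simp only [mul_one, fun k => ((φ k).moments_integral hB).1] at this
    exact (tendsto_nhds_unique this tendsto_const_nhds)
  have t2 := tendsto_integral_mul hQ2 hQ2 hX hX hQ hQ
  have m2 : ∫ ω, X ω * X ω ∂P = 2 * ∫ x, f x ^ 2 := by
    simp_rw [fun k => (φ k).integral_mul_integral hB (φ k)] at t2
    have a1 := tendsto_integral_mul hφ2 hφ2 hf hf hφ hφ
    have a2 := tendsto_integral_mul hφ2 (fun k => (φ k).memLp_toFun_swap 2) hf hf hφ hsw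
    rw [tendsto_nhds_unique t2 (a1.add a2), ← two_mul]
    simp_rw [sq]
  obtain ⟨C, hC⟩ := t2.bddAbove_range
  have hC4 : ∀ k, ∫ ω, (φ k).integral B ω ^ 4 ∂P ≤ 15 * C ^ 2 := by
    intro k
    refine ((φ k).moments_integral hB).2.2.trans ?_
    have h1 : ∫ ω, (φ k).integral B ω ^ 2 ∂P ≤ C := by
      simp_rw [sq]; exact hC ⟨k, rfl⟩
    have h0 : 0 ≤ ∫ ω, (φ k).integral B ω ^ 2 ∂P := integral_nonneg fun ω => sq_nonneg _
    gcongr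
  obtain ⟨b1, b2⟩ := memLp_four_of_tendsto hM hX.1 hC4 hQ
  have hX4 : MemLp X 4 P := ⟨hX.1, b2.trans_lt ENNReal.ofReal_lt_top⟩
  refine ⟨hX4, m1, by simp_rw [sq]; simpa only [sq] using m2, ?_⟩
  have t3 := tendsto_integral_pow_three ENNReal.ofReal_ne_top (fun k => hM k 4 (by simp)) hX4 hQ2
    hX b1 b2 hQ
  simp_rw [fun k => (φ k).integral_integral_pow_three hB] at t3
  exact tendsto_nhds_unique t3
    ((tendsto_cyclicForm (fun k => (φ k).symmetrize.memLp_toFun 2) hf hsy).const_mul 8)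

lemma toReal_eLpNorm_two_sq {α : Type*} [MeasurableSpace α] {μ : Measure α} {u : α → ℝ}
    (hu : MemLp u 2 μ) : (eLpNorm u 2 μ).toReal ^ 2 = ∫ x, u x * u x ∂μ := by
  rw [hu.eLpNorm_eq_integral_rpow_norm (by simp) (by simp), ENNReal.toReal_ofReal (by positivity),
    ENNReal.toReal_ofNat, ← one_div, ← Real.sqrt_eq_rpow, Real.sq_sqrt (by positivity)]
  exact integral_congr_ae (ae_of_all _ fun x => by simp [sq])

/-- The double integral is an `L²`-contraction up to the factor `√2`. -/
lemma OffDiagSimple.eLpNorm_integral_sub_le [IsProbabilityMeasure P]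
    (hB : IsBrownianRandomMeasure P B) (φ ψ : OffDiagSimple) :
    eLpNorm (φ.integral B - ψ.integral B) 2 P ≤ 2 * eLpNorm (φ.toFun - ψ.toFun) 2 volume := by
  have hφ := (φ.hasAllMoments_integral hB)
  have hψ := (ψ.hasAllMoments_integral hB)
  have hd : MemLp (φ.integral B - ψ.integral B) 2 P := (hφ 2 (by simp)).sub (hψ 2 (by simp))
  have hd' : MemLp (φ.toFun - ψ.toFun) 2 volume := (φ.memLp_toFun 2).sub (ψ.memLp_toFun 2)
  have hds : MemLp (fun x : ℝ × ℝ => (φ.toFun - ψ.toFun) x.swap) 2 volume :=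
    (φ.memLp_toFun_swap 2).sub (ψ.memLp_toFun_swap 2)
  have key : ∫ ω, (φ.integral B - ψ.integral B) ω * (φ.integral B - ψ.integral B) ω ∂P =
      (∫ x, (φ.toFun - ψ.toFun) x * (φ.toFun - ψ.toFun) x) +
        ∫ x, (φ.toFun - ψ.toFun) x * (φ.toFun - ψ.toFun) x.swap := by
    have i1 : ∫ ω, (φ.integral B - ψ.integral B) ω * (φ.integral B - ψ.integral B) ω ∂P =
        (∫ ω, φ.integral B ω * φ.integral B ω ∂P) - (∫ ω, φ.integral B ω * ψ.integral B ω ∂P) -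
        (∫ ω, ψ.integral B ω * φ.integral B ω ∂P) + ∫ ω, ψ.integral B ω * ψ.integral B ω ∂P := by
      rw [← integral_sub (hφ.mul hφ).integrable (hφ.mul hψ).integrable,
        ← integral_sub ((hφ.mul hφ).sub (hφ.mul hψ)).integrable (hψ.mul hφ).integrable,
        ← integral_add (((hφ.mul hφ).sub (hφ.mul hψ)).sub (hψ.mul hφ)).integrable
          (hψ.mul hψ).integrable]
      exact integral_congr_ae (ae_of_all _ fun ω => by simp only [Pi.sub_apply]; ring)
    have j : ∀ u v u' v' : ℝ × ℝ → ℝ, MemLp u 2 volume → MemLp v 2 volume → MemLp u' 2 volume →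
        MemLp v' 2 volume → ∫ x, (u - v) x * (u' - v') x = (∫ x, u x * u' x) - (∫ x, u x * v' x) -
          (∫ x, v x * u' x) + ∫ x, v x * v' x := by
      intro u v u' v' hu hv hu' hv'
      have a1 : Integrable (fun x => u x * u' x) volume := hu.integrable_mul hu'
      have a2 : Integrable (fun x => u x * v' x) volume := hu.integrable_mul hv'
      have a3 : Integrable (fun x => v x * u' x) volume := hv.integrable_mul hu'
      have a4 : Integrable (fun x => v x * v' x) volume := hv.integrable_mul hv'
      have a5 : Integrable (fun x => u x * u' x - u x * v' x) volume := a1.sub a2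
      have a6 : Integrable (fun x => u x * u' x - u x * v' x - v x * u' x) volume := a5.sub a3
      rw [← integral_sub a1 a2, ← integral_sub a5 a3, ← integral_add a6 a4]
      exact integral_congr_ae (ae_of_all _ fun ω => by simp only [Pi.sub_apply]; ring)
    have j1 := j _ _ _ _ (φ.memLp_toFun 2) (ψ.memLp_toFun 2) (φ.memLp_toFun 2) (ψ.memLp_toFun 2)
    have j2 := j _ _ _ _ (φ.memLp_toFun 2) (ψ.memLp_toFun 2) (φ.memLp_toFun_swap 2)
      (ψ.memLp_toFun_swap 2)
    simp only [Pi.sub_apply] at i1 j1 j2 ⊢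
    rw [i1, j1, j2, φ.integral_mul_integral hB φ, φ.integral_mul_integral hB ψ,
      ψ.integral_mul_integral hB φ, ψ.integral_mul_integral hB ψ]
    ring
  have hswap : eLpNorm (fun x : ℝ × ℝ => (φ.toFun - ψ.toFun) x.swap) 2 volume =
      eLpNorm (φ.toFun - ψ.toFun) 2 volume := by
    have := eLpNorm_comp_measurePreserving (p := 2) hd'.1
      (Measure.measurePreserving_swap (μ := (volume : Measure ℝ)) (ν := (volume : Measure ℝ)))
    rwa [← Measure.volume_eq_prod] at this
  have hb := abs_integral_mul_le hd' hds
  rw [hswap, ENNReal.toReal_mul, ← sq] at hb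
  rw [← toReal_eLpNorm_two_sq hd, ← toReal_eLpNorm_two_sq hd'] at key
  have hle : (eLpNorm (φ.integral B - ψ.integral B) 2 P).toReal ≤
      2 * (eLpNorm (φ.toFun - ψ.toFun) 2 volume).toReal := by
    refine le_of_sq_le_sq ?_ (by positivity)
    rw [key, mul_pow]
    nlinarith [le_abs_self (∫ x, (φ.toFun - ψ.toFun) x * (φ.toFun - ψ.toFun) x.swap),
      sq_nonneg (eLpNorm (φ.toFun - ψ.toFun) 2 volume).toReal]
  refine (ENNReal.toReal_le_toReal hd.2.ne (ENNReal.mul_ne_top (by simp) hd'.2.ne)).1 ?_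
  simpa [ENNReal.toReal_mul] using hle

end DoubleIntegralMoments

section Density

/-- Sampling of `g` on the grid of mesh `1 / N` of the square `[-R, R)²`, off the diagonal. -/
def gridSample (g : ℝ × ℝ → ℝ) (R N : ℕ) : OffDiagSimple where
  n := 2 * R * N
  sets i := if N = 0 then ∅ else Set.Ico ((i : ℝ) / N - R) (((i : ℝ) + 1) / N - R)
  measurableSet_sets i := by
    split_ifs
    · exact MeasurableSet.empty
    · exact measurableSet_Ico
  volume_sets_lt_top i := by
    split_ifs
    · simp
    · simp
  disjoint_sets i j hij := by
    rcases Nat.eq_zero_or_pos N with hN | hN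
    · simp [hN]
    have hN' : (0 : ℝ) < N := by exact_mod_cast hN
    simp only [hN.ne', if_false]
    rw [Set.disjoint_left]
    rintro t ⟨h1, h2⟩ ⟨h3, h4⟩
    apply hij
    ext
    rw [sub_le_iff_le_add, div_le_iff₀ hN'] at h1 h3
    rw [lt_sub_iff_add_lt, lt_div_iff₀ hN'] at h2 h4
    have a1 : (i : ℝ) < j + 1 := h1.trans_lt h4
    have a2 : (j : ℝ) < i + 1 := h3.trans_lt h2
    norm_cast at a1 a2
    omega
  coeff i j := if i = j then 0 else g ((i : ℝ) / N - R, (j : ℝ) / N - R)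
  coeff_diag i := by simp

/-- The left end point of the cell of the grid that contains `t`. -/
def gridPoint (R N : ℕ) (t : ℝ) : ℝ := (⌊(t + R) * N⌋₊ : ℝ) / N - R

lemma tendsto_gridPoint {R : ℕ} {t : ℝ} (ht : -(R : ℝ) ≤ t) :
    Tendsto (fun N => gridPoint R N t) atTop (𝓝 t) := by
  have h := (tendsto_nat_floor_mul_div_atTop (R := ℝ) (a := t + R) (by linarith)).comp
    tendsto_natCast_atTop_atTop
  simpa [gridPoint, Function.comp_def] using h.sub_const (R : ℝ)

lemma indicator_gridSample_of_mem (g : ℝ × ℝ → ℝ) {R N : ℕ} (hN : 0 < N) {t : ℝ}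
    (ht : t ∈ Set.Ico (-(R : ℝ)) R) :
    ∃ a : Fin (2 * R * N), (a : ℝ) / N - R = gridPoint R N t ∧ ∀ i : Fin (2 * R * N),
      ((gridSample g R N).sets i).indicator (fun _ => (1 : ℝ)) t = if i = a then 1 else 0 := by
  have hN' : (0 : ℝ) < N := by exact_mod_cast hN
  have h0 : 0 ≤ (t + R) * N := mul_nonneg (by linarith [ht.1]) hN'.le
  have hlt : ⌊(t + R) * N⌋₊ < 2 * R * N := by
    rw [Nat.floor_lt h0]
    push_cast
    have : t + R < 2 * R := by linarith [ht.2]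
    gcongr
  refine ⟨⟨_, hlt⟩, rfl, fun i => ?_⟩
  have hmem : t ∈ (gridSample g R N).sets (⟨_, hlt⟩ : Fin (2 * R * N)) := by
    simp only [gridSample, hN.ne', if_false, Set.mem_Ico]
    constructor
    · rw [sub_le_iff_le_add, div_le_iff₀ hN']
      exact Nat.floor_le h0
    · rw [lt_sub_iff_add_lt, lt_div_iff₀ hN']
      exact Nat.lt_floor_add_one _
  split_ifs with hi
  · subst hi
    rw [Set.indicator_of_mem hmem]
  · exact Set.indicator_of_notMem (fun h =>
      Set.disjoint_left.1 ((gridSample g R N).disjoint_sets hi) h hmem) _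

lemma indicator_gridSample_of_notMem (g : ℝ × ℝ → ℝ) {R N : ℕ} {t : ℝ}
    (ht : t ∉ Set.Ico (-(R : ℝ)) R) (i : Fin (2 * R * N)) :
    ((gridSample g R N).sets i).indicator (fun _ => (1 : ℝ)) t = 0 := by
  refine Set.indicator_of_notMem (fun h => ht ?_) _
  rcases Nat.eq_zero_or_pos N with hN | hN
  · simp [gridSample, hN] at h
  have hN' : (0 : ℝ) < N := by exact_mod_cast hN
  simp only [gridSample, hN.ne', if_false, Set.mem_Ico] at h
  have hi : ((i : ℕ) : ℝ) + 1 ≤ 2 * R * N := by exact_mod_cast i.2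
  constructor
  · have : (0 : ℝ) ≤ (i : ℝ) / N := by positivity
    linarith [h.1]
  · have : ((i : ℝ) + 1) / N ≤ 2 * R := by rwa [div_le_iff₀ hN']
    linarith [h.2]

lemma gridSample_toFun_of_mem (g : ℝ × ℝ → ℝ) {R N : ℕ} (hN : 0 < N) {x : ℝ × ℝ}
    (h1 : x.1 ∈ Set.Ico (-(R : ℝ)) R) (h2 : x.2 ∈ Set.Ico (-(R : ℝ)) R) :
    (gridSample g R N).toFun x = if gridPoint R N x.1 = gridPoint R N x.2 then 0 else
      g (gridPoint R N x.1, gridPoint R N x.2) := by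
  obtain ⟨a, ha, ha'⟩ := indicator_gridSample_of_mem g hN h1
  obtain ⟨b, hb, hb'⟩ := indicator_gridSample_of_mem g hN h2
  have hN' : (N : ℝ) ≠ 0 := by exact_mod_cast hN.ne'
  have hab : a = b ↔ gridPoint R N x.1 = gridPoint R N x.2 := by
    rw [← ha, ← hb, sub_left_inj, div_left_inj' hN', Nat.cast_inj, Fin.ext_iff]
  change ∑ i : Fin (2 * R * N), ∑ j : Fin (2 * R * N), _ = _
  simp_rw [ha', hb']
  simp only [mul_ite, mul_one, mul_zero, Finset.sum_ite_eq', Finset.mem_univ, if_true]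
  change (if a = b then 0 else g ((a : ℝ) / N - R, (b : ℝ) / N - R)) = _
  simp only [hab, ha, hb]

lemma gridSample_toFun_of_notMem (g : ℝ × ℝ → ℝ) {R N : ℕ} {x : ℝ × ℝ}
    (h : x ∉ Set.Ico (-(R : ℝ)) R ×ˢ Set.Ico (-(R : ℝ)) R) :
    (gridSample g R N).toFun x = 0 := by
  refine Finset.sum_eq_zero fun i _ => Finset.sum_eq_zero fun j _ => ?_
  rw [Set.mem_prod, not_and_or] at h
  rcases h with h | h
  · rw [indicator_gridSample_of_notMem g h i]; simp
  · rw [indicator_gridSample_of_notMem g h j]; simp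

lemma ae_fst_ne_snd : ∀ᵐ x : ℝ × ℝ, x.1 ≠ x.2 := by
  rw [Measure.volume_eq_prod, Measure.ae_prod_iff_ae_ae]
  · refine ae_of_all _ fun x => ?_
    filter_upwards [Measure.ae_ne volume x] with y hy using Ne.symm hy
  · exact (measurableSet_eq_fun measurable_fst measurable_snd).compl

lemma OffDiagSimple.measurable_toFun (φ : OffDiagSimple) : Measurable φ.toFun := by
  refine Finset.measurable_sum _ fun i _ => Finset.measurable_sum _ fun j _ => ?_
  exact (((measurable_const.indicator (φ.measurableSet_sets i)).comp measurable_fst).mul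
    ((measurable_const.indicator (φ.measurableSet_sets j)).comp measurable_snd)).const_mul _

lemma tendsto_gridSample {g : ℝ × ℝ → ℝ} (hg : Continuous g) {M : ℝ} (hM : ∀ x, |g x| ≤ M)
    {R : ℕ} (hR : ∀ x, x ∉ Set.Ico (-(R : ℝ)) R ×ˢ Set.Ico (-(R : ℝ)) R → g x = 0) :
    Tendsto (fun N => eLpNorm ((gridSample g R N).toFun - g) 2 volume) atTop (𝓝 0) := by
  set S : Set (ℝ × ℝ) := Set.Ico (-(R : ℝ)) R ×ˢ Set.Ico (-(R : ℝ)) R with hS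
  have hSm : MeasurableSet S := measurableSet_Ico.prod measurableSet_Ico
  have hM0 : 0 ≤ M := (abs_nonneg _).trans (hM 0)
  have hmain : Tendsto (fun N => ∫⁻ x, ‖((gridSample g R N).toFun - g) x‖ₑ ^ (2 : ℝ)) atTop
      (𝓝 (∫⁻ _ : ℝ × ℝ, 0)) := by
    refine tendsto_lintegral_filter_of_dominated_convergence
      (S.indicator fun _ => ENNReal.ofReal (2 * M) ^ (2 : ℝ)) ?_ ?_ ?_ ?_
    · refine Eventually.of_forall fun N => ?_
      exact (((gridSample g R N).measurable_toFun.sub hg.measurable).enorm).pow_const _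
    · filter_upwards [eventually_gt_atTop 0] with N hN
      refine ae_of_all _ fun x => ?_
      by_cases hx : x ∈ S
      · rw [Set.indicator_of_mem hx]
        gcongr
        rw [Real.enorm_eq_ofReal_abs]
        refine ENNReal.ofReal_le_ofReal ?_
        rw [Pi.sub_apply, two_mul]
        refine (abs_sub _ _).trans (add_le_add ?_ (hM x))
        rw [gridSample_toFun_of_mem g hN hx.1 hx.2]
        split_ifs
        · simpa using hM0
        · exact hM _
      · rw [Set.indicator_of_notMem hx, Pi.sub_apply, gridSample_toFun_of_notMem g hx, hR x hx]
        simp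
    · rw [lintegral_indicator_const hSm, Measure.volume_eq_prod, Measure.prod_prod]
      simp only [Real.volume_Ico]
      finiteness
    · filter_upwards [ae_fst_ne_snd] with x hne
      by_cases hx : x ∈ S
      · have t1 := tendsto_gridPoint (R := R) hx.1.1
        have t2 := tendsto_gridPoint (R := R) hx.2.1
        have ev : ∀ᶠ N in atTop, gridPoint R N x.1 ≠ gridPoint R N x.2 := by
          have := (t1.sub t2).eventually_ne (sub_ne_zero.2 hne)
          filter_upwards [this] with N hN using sub_ne_zero.1 hN
        have t3 : Tendsto (fun N => (gridSample g R N).toFun x) atTop (𝓝 (g x)) := by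
          have h3 := (hg.tendsto x).comp (t1.prodMk_nhds t2)
          refine h3.congr' ?_
          filter_upwards [ev, eventually_gt_atTop 0] with N h1 h2
          rw [gridSample_toFun_of_mem g h2 hx.1 hx.2, if_neg h1]
          rfl
        have t4 := ((t3.sub_const (g x)).enorm).ennrpow_const (2 : ℝ)
        simpa using t4
      · simp [gridSample_toFun_of_notMem g hx, hR x hx]
  simp_rw [eLpNorm_eq_lintegral_rpow_enorm_toReal (two_ne_zero (α := ℝ≥0∞)) ENNReal.ofNat_ne_top]
  simpa using hmain.ennrpow_const (1 / 2 : ℝ)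

lemma exists_offDiagSimple_eLpNorm_sub_le {f : ℝ × ℝ → ℝ} (hf : MemLp f 2 volume) {ε : ℝ≥0∞}
    (hε : ε ≠ 0) : ∃ φ : OffDiagSimple, eLpNorm (φ.toFun - f) 2 volume ≤ ε := by
  obtain ⟨g, hgs, hgf, hgc, hgm⟩ := hf.exists_hasCompactSupport_eLpNorm_sub_le (by simp)
    (ENNReal.half_pos hε).ne'
  obtain ⟨M, hM⟩ := hgc.bounded_above_of_compact_support hgs
  obtain ⟨r, hr⟩ := hgs.isBounded.subset_closedBall (0 : ℝ × ℝ)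
  obtain ⟨R, hR⟩ := exists_nat_gt r
  have hzero : ∀ x, x ∉ Set.Ico (-(R : ℝ)) R ×ˢ Set.Ico (-(R : ℝ)) R → g x = 0 := by
    intro x hx
    by_contra hne
    apply hx
    have := hr (subset_tsupport _ hne)
    rw [mem_closedBall_zero_iff, Prod.norm_def, max_le_iff, Real.norm_eq_abs, Real.norm_eq_abs,
      abs_le, abs_le] at this
    exact ⟨⟨by linarith [this.1.1], by linarith [this.1.2]⟩,
      ⟨by linarith [this.2.1], by linarith [this.2.2]⟩⟩
  have ht := tendsto_gridSample hgc (fun x => by simpa using hM x) hzero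
  obtain ⟨N, hN⟩ := ((ENNReal.tendsto_nhds_zero.1 ht) (ε / 2)
    (ENNReal.half_pos hε)).exists
  refine ⟨gridSample g R N, ?_⟩
  have h1 : (gridSample g R N).toFun - f = ((gridSample g R N).toFun - g) + (g - f) := by abel
  rw [h1]
  refine (eLpNorm_add_le (((gridSample g R N).memLp_toFun 2).sub hgm).1 (hgm.sub hf).1
    one_le_two).trans ?_
  rw [eLpNorm_sub_comm g f]
  exact (add_le_add hN hgf).trans (ENNReal.add_halves ε).le

end Density

section Existence

variable {Ω : Type*} [MeasurableSpace Ω] {P : Measure Ω} {B : Set ℝ → Ω → ℝ}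

/-- The double Wiener–Itô integral of a square integrable kernel exists. -/
theorem exists_isDoubleWienerIto [IsProbabilityMeasure P] (hB : IsBrownianRandomMeasure P B)
    {f : ℝ × ℝ → ℝ} (hf : MemLp f 2 volume) : ∃ X, IsDoubleWienerIto P B f X := by
  have hε : ∀ k : ℕ, ((2 : ℝ≥0∞)⁻¹ ^ k) ≠ 0 := fun k => pow_ne_zero _ (by simp)
  choose φ hφ using fun k => exists_offDiagSimple_eLpNorm_sub_le hf (hε k)
  have hφt : Tendsto (fun k => eLpNorm ((φ k).toFun - f) 2 volume) atTop (𝓝 0) :=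
    tendsto_of_tendsto_of_tendsto_of_le_of_le tendsto_const_nhds
      (ENNReal.tendsto_pow_atTop_nhds_zero_of_lt_one (by simp)) (fun _ => zero_le) hφ
  obtain ⟨X, hX, hXt⟩ := Lp.cauchy_complete_eLpNorm (p := 2) (μ := P) one_le_two
    (f := fun k => (φ k).integral B) (fun k => (φ k).hasAllMoments_integral hB 2 (by simp))
    (B := fun k => 5 * (2 : ℝ≥0∞)⁻¹ ^ k) (by
      rw [ENNReal.tsum_mul_left, ENNReal.tsum_geometric]
      simp [ENNReal.mul_eq_top]) (by
      intro N n m hn hm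
      have hle : ∀ i, N ≤ i → eLpNorm ((φ i).toFun - f) 2 volume ≤ (2 : ℝ≥0∞)⁻¹ ^ N := fun i hi =>
        (hφ i).trans (pow_le_pow_of_le_one zero_le (by simp) hi)
      refine ((φ n).eLpNorm_integral_sub_le hB (φ m)).trans_lt ?_
      have h1 : (φ n).toFun - (φ m).toFun = ((φ n).toFun - f) - ((φ m).toFun - f) := by abel
      rw [h1]
      refine (mul_le_mul' le_rfl (eLpNorm_sub_le (((φ n).memLp_toFun 2).sub hf).1
        (((φ m).memLp_toFun 2).sub hf).1 one_le_two)).trans_lt ?_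
      refine (mul_le_mul' le_rfl (add_le_add (hle n hn) (hle m hm))).trans_lt ?_
      rw [← two_mul, ← mul_assoc]
      refine ENNReal.mul_lt_mul_left (hε N) (by finiteness) ?_
      norm_num)
  exact ⟨X, hf, hX, φ, hφt, hXt⟩

lemma isDoubleWienerIto_doubleWienerIto [IsProbabilityMeasure P]
    (hB : IsBrownianRandomMeasure P B) {f : ℝ × ℝ → ℝ} (hf : MemLp f 2 volume) :
    IsDoubleWienerIto P B f (doubleWienerIto P B f) := by
  have h := exists_isDoubleWienerIto hB hf
  rw [doubleWienerIto, dif_pos h]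
  exact h.choose_spec

end Existence

section TruncatedPowers

/-- The truncated power `u_+^γ`, with values in `[0, ∞]`. -/
def epow (γ u : ℝ) : ℝ≥0∞ := ENNReal.ofReal (posPow u γ)

lemma posPow_nonneg (u γ : ℝ) : 0 ≤ posPow u γ := by
  unfold posPow
  split_ifs with h
  · positivity
  · exact le_rfl

lemma measurable_posPow (γ : ℝ) : Measurable fun u => posPow u γ :=
  Measurable.ite measurableSet_Ioi (by fun_prop) measurable_const

@[fun_prop]
lemma measurable_epow (γ : ℝ) : Measurable (epow γ) := (measurable_posPow γ).ennreal_ofReal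

lemma epow_of_pos {γ u : ℝ} (hu : 0 < u) : epow γ u = ENNReal.ofReal (u ^ γ) := by
  rw [epow, posPow, if_pos hu]

lemma epow_of_nonpos {γ u : ℝ} (hu : u ≤ 0) : epow γ u = 0 := by
  rw [epow, posPow, if_neg hu.not_gt, ENNReal.ofReal_zero]

lemma epow_ne_top (γ u : ℝ) : epow γ u ≠ ∞ := ENNReal.ofReal_ne_top

lemma epow_mul_epow (a b u : ℝ) : epow a u * epow b u = epow (a + b) u := by
  rcases lt_or_ge 0 u with hu | hu
  · rw [epow_of_pos hu, epow_of_pos hu, epow_of_pos hu, ← ENNReal.ofReal_mul (by positivity),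
      Real.rpow_add hu]
  · simp [epow_of_nonpos hu]

lemma epow_mul_left (a : ℝ) {r : ℝ} (hr : 0 < r) (u : ℝ) :
    epow a (r * u) = ENNReal.ofReal (r ^ a) * epow a u := by
  rcases lt_or_ge 0 u with hu | hu
  · rw [epow_of_pos hu, epow_of_pos (mul_pos hr hu), ← ENNReal.ofReal_mul (by positivity),
      Real.mul_rpow hr.le hu.le]
  · rw [epow_of_nonpos hu, epow_of_nonpos (mul_nonpos_of_nonneg_of_nonpos hr.le hu), mul_zero]

lemma lintegral_ofReal_of_integral_pos {α : Type*} [MeasurableSpace α] {μ : Measure α}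
    {f : α → ℝ} (hf : 0 ≤ᵐ[μ] f) {c : ℝ} (h : ∫ x, f x ∂μ = c) (hc : 0 < c) :
    ∫⁻ x, ENNReal.ofReal (f x) ∂μ = ENNReal.ofReal c := by
  have hi : Integrable f μ := by
    by_contra hn
    rw [integral_undef hn] at h
    exact hc.ne h
  rw [← ofReal_integral_eq_lintegral_ofReal hi hf, h]

lemma lintegral_epow_mul_exp {a r : ℝ} (ha : -1 < a) (hr : 0 < r) :
    ∫⁻ u, epow a u * ENNReal.ofReal (Real.exp (-(r * u))) =
      ENNReal.ofReal (Real.Gamma (a + 1)) * ENNReal.ofReal (r ^ (-a - 1)) := by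
  have h1 : ∫⁻ u, epow a u * ENNReal.ofReal (Real.exp (-(r * u))) =
      ∫⁻ u in Set.Ioi 0, ENNReal.ofReal (u ^ (a + 1 - 1) * Real.exp (-(r * u))) := by
    rw [← lintegral_indicator measurableSet_Ioi]
    refine lintegral_congr fun u => ?_
    rcases lt_or_ge 0 u with hu | hu
    · rw [Set.indicator_of_mem (Set.mem_Ioi.2 hu), epow_of_pos hu,
        ENNReal.ofReal_mul (by positivity), add_sub_cancel_right]
    · rw [epow_of_nonpos hu, Set.indicator_of_notMem (by simpa using hu), zero_mul]
  have ha' : 0 < a + 1 := by linarith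
  have hG := Real.Gamma_pos_of_pos ha'
  rw [h1, lintegral_ofReal_of_integral_pos _ (Real.integral_rpow_mul_exp_neg_mul_Ioi ha' hr)
    (by positivity), ← ENNReal.ofReal_mul hG.le]
  · congr 1
    rw [one_div, Real.inv_rpow hr.le, ← Real.rpow_neg hr.le, mul_comm]
    ring_nf
  · filter_upwards [ae_restrict_mem measurableSet_Ioi] with u hu
    have : (0 : ℝ) < u := hu
    simp only [Pi.zero_apply]
    positivity

lemma lintegral_epow_mul_epow_add {a b d : ℝ} (ha : -1 < a) (hab : a + b < -1) (hb : b < 0)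
    (hd : 0 < d) :
    ∫⁻ u, epow a u * epow b (d + u) =
      ENNReal.ofReal (beta (a + 1) (-a - b - 1)) * epow (a + b + 1) d := by
  have hGb := Real.Gamma_pos_of_pos (neg_pos.2 hb)
  have h1 : ∀ u, ENNReal.ofReal (Real.Gamma (-b)) * (epow a u * epow b (d + u)) =
      ∫⁻ w, epow a u * (epow (-b - 1) w * ENNReal.ofReal (Real.exp (-((d + u) * w)))) := by
    intro u
    rcases lt_or_ge 0 u with hu | hu
    · have hdu : 0 < d + u := by linarith
      rw [lintegral_const_mul _ (by fun_prop), lintegral_epow_mul_exp (by linarith) hdu,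
        epow_of_pos hdu, sub_add_cancel, show -(-b - 1) - 1 = b by ring]
      ring
    · simp [epow_of_nonpos hu]
  have h2 : ENNReal.ofReal (Real.Gamma (-b)) * ∫⁻ u, epow a u * epow b (d + u) =
      ENNReal.ofReal (Real.Gamma (a + 1)) * (ENNReal.ofReal (Real.Gamma (-a - b - 1)) *
        epow (a + b + 1) d) := by
    rw [← lintegral_const_mul _ (by fun_prop)]
    simp_rw [h1]
    rw [lintegral_lintegral_swap (by fun_prop)]
    have h3 : ∀ w, ∫⁻ u, epow a u * (epow (-b - 1) w * ENNReal.ofReal (Real.exp (-((d + u) * w)))) =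
        ENNReal.ofReal (Real.Gamma (a + 1)) *
          (epow (-a - b - 2) w * ENNReal.ofReal (Real.exp (-(d * w)))) := by
      intro w
      rcases lt_or_ge 0 w with hw | hw
      · have h4 : ∀ u, epow a u * (epow (-b - 1) w * ENNReal.ofReal (Real.exp (-((d + u) * w)))) =
            epow (-b - 1) w * ENNReal.ofReal (Real.exp (-(d * w))) *
              (epow a u * ENNReal.ofReal (Real.exp (-(w * u)))) := by
          intro u
          rw [show -((d + u) * w) = -(d * w) + -(w * u) by ring, Real.exp_add,
            ENNReal.ofReal_mul (Real.exp_pos _).le]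
          ring
        simp_rw [h4]
        rw [lintegral_const_mul _ (by fun_prop), lintegral_epow_mul_exp ha hw,
          ← epow_of_pos (γ := -a - 1) hw, show -a - b - 2 = (-b - 1) + (-a - 1) by ring,
          ← epow_mul_epow]
        ring
      · simp [epow_of_nonpos hw]
    simp_rw [h3]
    rw [lintegral_const_mul _ (by fun_prop), lintegral_epow_mul_exp (by linarith) hd,
      epow_of_pos hd]
    ring_nf
  have hne : ENNReal.ofReal (Real.Gamma (-b)) ≠ 0 := by simpa using hGb
  have h5 : ENNReal.ofReal (Real.Gamma (-b)) * ENNReal.ofReal (beta (a + 1) (-a - b - 1)) =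
      ENNReal.ofReal (Real.Gamma (a + 1)) * ENNReal.ofReal (Real.Gamma (-a - b - 1)) := by
    have g1 := Real.Gamma_pos_of_pos (show 0 < a + 1 by linarith)
    rw [← ENNReal.ofReal_mul hGb.le, ← ENNReal.ofReal_mul g1.le, beta,
      show a + 1 + (-a - b - 1) = -b by ring, mul_div_cancel₀ _ hGb.ne']
  refine (ENNReal.mul_right_inj hne ENNReal.ofReal_ne_top).1 ?_
  rw [h2, ← mul_assoc, ← mul_assoc, h5]

/-- The cross-correlation of two truncated powers. -/
lemma lintegral_epow_sub_mul_epow_sub {a b s t : ℝ} (ha : -1 < a) (hab : a + b < -1) (hb : b < 0)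
    (hst : s < t) :
    ∫⁻ x, epow a (s - x) * epow b (t - x) =
      ENNReal.ofReal (beta (a + 1) (-a - b - 1)) * epow (a + b + 1) (t - s) := by
  rw [← lintegral_epow_mul_epow_add ha hab hb (sub_pos.2 hst),
    ← lintegral_sub_left_eq_self (fun u => epow a u * epow b (t - s + u)) s]
  refine lintegral_congr fun x => ?_
  congr 2
  ring

lemma lintegral_epow_mul_epow_one_sub {a b : ℝ} (ha : -1 < a) (hb : -1 < b) :
    ∫⁻ u, epow a u * epow b (1 - u) = ENNReal.ofReal (beta (a + 1) (b + 1)) := by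
  have ha' : 0 < a + 1 := by linarith
  have hb' : 0 < b + 1 := by linarith
  have hβ := beta_pos ha' hb'
  have h1 : ∀ u, epow a u * epow b (1 - u) =
      ENNReal.ofReal (beta (a + 1) (b + 1)) * betaPDF (a + 1) (b + 1) u := by
    intro u
    rcases le_or_gt u 0 with h0 | h0
    · rw [epow_of_nonpos h0, betaPDF_eq_zero_of_nonpos h0]; simp
    rcases le_or_gt 1 u with h1 | h1
    · rw [epow_of_nonpos (sub_nonpos.2 h1), betaPDF_eq_zero_of_one_le h1]; simp
    have h1' : 0 < 1 - u := sub_pos.2 h1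
    rw [epow_of_pos h0, epow_of_pos h1', betaPDF_of_pos_lt_one h0 h1,
      ← ENNReal.ofReal_mul (by positivity), ← ENNReal.ofReal_mul hβ.le]
    congr 1
    field_simp
    simp
  simp_rw [h1]
  rw [lintegral_const_mul' _ _ ENNReal.ofReal_ne_top, lintegral_betaPDF_eq_one ha' hb', mul_one]

/-- The convolution of two truncated powers. -/
lemma lintegral_epow_sub_mul_epow {a b : ℝ} (ha : -1 < a) (hb : -1 < b) (s t : ℝ) :
    ∫⁻ x, epow a (x - s) * epow b (t - x) =
      ENNReal.ofReal (beta (a + 1) (b + 1)) * epow (a + b + 1) (t - s) := by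
  rcases le_or_gt t s with hst | hst
  · rw [epow_of_nonpos (sub_nonpos.2 hst), mul_zero]
    rw [← lintegral_zero (μ := (volume : Measure ℝ))]
    refine lintegral_congr fun x => ?_
    rcases le_total x s with h | h
    · rw [epow_of_nonpos (sub_nonpos.2 h), zero_mul]
    · rw [epow_of_nonpos (u := t - x) (by linarith), mul_zero]
  set r := t - s with hr
  have hr0 : 0 < r := sub_pos.2 hst
  have hshift : ∫⁻ x, epow a (x - s) * epow b (t - x) = ∫⁻ x, epow a x * epow b (r - x) := by
    rw [← lintegral_sub_right_eq_self (fun x => epow a x * epow b (r - x)) s]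
    refine lintegral_congr fun x => ?_
    rw [hr]
    congr 2
    ring
  have h1 : ∫⁻ u, epow a (r * u) * epow b (r - r * u) =
      ENNReal.ofReal |r⁻¹| * ∫⁻ x, epow a (x - s) * epow b (t - x) := by
    rw [hshift, ← smul_eq_mul, ← lintegral_smul_measure, ← Real.map_volume_mul_left hr0.ne',
      lintegral_map (by fun_prop) (by fun_prop)]
  have h2 : ∀ u, epow a (r * u) * epow b (r - r * u) =
      ENNReal.ofReal (r ^ a) * ENNReal.ofReal (r ^ b) * (epow a u * epow b (1 - u)) := by
    intro u
    rw [show r - r * u = r * (1 - u) by ring, epow_mul_left a hr0, epow_mul_left b hr0]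
    ring
  simp_rw [h2] at h1
  rw [lintegral_const_mul _ (by fun_prop), lintegral_epow_mul_epow_one_sub ha hb] at h1
  have h3 : ∫⁻ x, epow a (x - s) * epow b (t - x) = ENNReal.ofReal r *
      (ENNReal.ofReal |r⁻¹| * ∫⁻ x, epow a (x - s) * epow b (t - x)) := by
    rw [← mul_assoc, ← ENNReal.ofReal_mul hr0.le, abs_of_pos (by positivity),
      mul_inv_cancel₀ hr0.ne', ENNReal.ofReal_one, one_mul]
  rw [h3, ← h1, ← epow_mul_epow, ← epow_mul_epow, epow_of_pos hr0, epow_of_pos hr0,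
    epow_of_pos hr0, Real.rpow_one]
  ring

end TruncatedPowers

section OrderedIntegrals

lemma beta_one_left {x : ℝ} (hx : 0 < x) : beta 1 x = 1 / x := by
  rw [beta, Real.Gamma_one, add_comm, Real.Gamma_add_one hx.ne']
  have := (Real.Gamma_pos_of_pos hx).ne'
  field_simp

lemma beta_one_right {x : ℝ} (hx : 0 < x) : beta x 1 = 1 / x := by
  rw [← beta_one_left hx, beta, beta, mul_comm, add_comm]

lemma lintegral_ordered_two {e : ℝ} (he : -1 < e) :
    ∫⁻ a, ∫⁻ c, epow 0 a * epow 0 (1 - c) * epow e (c - a) =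
      ENNReal.ofReal (1 / ((e + 1) * (e + 2))) := by
  rw [lintegral_lintegral_swap (by fun_prop)]
  have h1 : ∀ c, ∫⁻ a, epow 0 a * epow 0 (1 - c) * epow e (c - a) =
      ENNReal.ofReal (1 / (e + 1)) * (epow (e + 1) c * epow 0 (1 - c)) := by
    intro c
    have h2 : ∀ a, epow 0 a * epow 0 (1 - c) * epow e (c - a) =
        epow 0 (1 - c) * (epow 0 (a - 0) * epow e (c - a)) := fun a => by rw [sub_zero]; ring
    simp_rw [h2]
    rw [lintegral_const_mul _ (by fun_prop), lintegral_epow_sub_mul_epow (by norm_num) he, zero_add,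
      zero_add, sub_zero, beta_one_left (by linarith)]
    ring
  simp_rw [h1]
  rw [lintegral_const_mul _ (by fun_prop), lintegral_epow_mul_epow_one_sub (by linarith)
    (by norm_num), zero_add, beta_one_right (by linarith), ← ENNReal.ofReal_mul]
  · congr 1
    have : e + 1 ≠ 0 := by linarith
    have : e + 1 + 1 ≠ 0 := by linarith
    rw [one_div_mul_one_div]
    ring_nf
  · have : 0 < e + 1 := by linarith
    positivity

lemma lintegral_ordered_three {p q r : ℝ} (hp : -1 < p) (hq : -1 < q)
    (he : -1 < p + q + r + 1) :
    ∫⁻ a, ∫⁻ b, ∫⁻ c, epow 0 a * epow 0 (1 - c) *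
        (epow r (c - a) * epow p (b - a) * epow q (c - b)) =
      ENNReal.ofReal (beta (p + 1) (q + 1)) *
        ENNReal.ofReal (1 / ((p + q + r + 2) * (p + q + r + 3))) := by
  have h1 : ∀ a, ∫⁻ b, ∫⁻ c, epow 0 a * epow 0 (1 - c) *
        (epow r (c - a) * epow p (b - a) * epow q (c - b)) =
      ENNReal.ofReal (beta (p + 1) (q + 1)) *
        ∫⁻ c, epow 0 a * epow 0 (1 - c) * epow (p + q + r + 1) (c - a) := by
    intro a
    rw [lintegral_lintegral_swap (by fun_prop), ← lintegral_const_mul _ (by fun_prop)]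
    refine lintegral_congr fun c => ?_
    have h2 : ∀ b, epow 0 a * epow 0 (1 - c) * (epow r (c - a) * epow p (b - a) * epow q (c - b)) =
        epow 0 a * epow 0 (1 - c) * epow r (c - a) * (epow p (b - a) * epow q (c - b)) :=
      fun b => by ring
    simp_rw [h2]
    rw [lintegral_const_mul _ (by fun_prop), lintegral_epow_sub_mul_epow hp hq,
      show p + q + r + 1 = r + (p + q + 1) by ring, ← epow_mul_epow r]
    ring
  simp_rw [h1]
  have hm : Measurable fun a => ∫⁻ c, epow 0 a * epow 0 (1 - c) * epow (p + q + r + 1) (c - a) :=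
    Measurable.lintegral_prod_right' (f := fun z : ℝ × ℝ =>
      epow 0 z.1 * epow 0 (1 - z.2) * epow (p + q + r + 1) (z.2 - z.1)) (by fun_prop)
  rw [lintegral_const_mul _ hm, lintegral_ordered_two he]
  ring_nf

lemma setLIntegral_unit_eq (f : ℝ → ℝ≥0∞) :
    ∫⁻ s in Set.Ioc 0 1, f s = ∫⁻ s, epow 0 s * epow 0 (1 - s) * f s := by
  rw [← setLIntegral_congr Ioo_ae_eq_Ioc, ← lintegral_indicator measurableSet_Ioo]
  refine lintegral_congr fun s => ?_
  by_cases hs : s ∈ Set.Ioo (0 : ℝ) 1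
  · rw [Set.indicator_of_mem hs, epow_of_pos hs.1, epow_of_pos (sub_pos.2 hs.2)]
    simp
  · rw [Set.indicator_of_notMem hs]
    rw [Set.mem_Ioo, not_and_or, not_lt, not_lt] at hs
    rcases hs with h | h
    · simp [epow_of_nonpos h]
    · simp [epow_of_nonpos (sub_nonpos.2 h)]

variable {ν : Measure ℝ} [SFinite ν] [NullSingletonClass ν]

lemma lintegral_symm_two {W : ℝ → ℝ → ℝ≥0∞} (hW : Measurable (Function.uncurry W))
    (hs : ∀ a b, W a b = W b a) :
    ∫⁻ a, ∫⁻ b, W a b ∂ν ∂ν = 2 * ∫⁻ a, ∫⁻ b, (if a < b then W a b else 0) ∂ν ∂ν := by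
  set T : ℝ → ℝ → ℝ≥0∞ := fun a b => if a < b then W a b else 0 with hT
  have hTm : Measurable (Function.uncurry T) :=
    Measurable.ite (measurableSet_lt measurable_fst measurable_snd) hW measurable_const
  have h1 : ∫⁻ a, ∫⁻ b, W a b ∂ν ∂ν = ∫⁻ a, ∫⁻ b, (T a b + T b a) ∂ν ∂ν := by
    refine lintegral_congr fun a => lintegral_congr_ae ?_
    filter_upwards [Measure.ae_ne ν a] with b hb
    rcases lt_or_gt_of_ne hb with h | h
    · simp [hT, h, h.not_gt, hs]
    · simp [hT, h, h.not_gt]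
  have hTa : ∀ a, Measurable (T a) := fun a => hTm.comp measurable_prodMk_left
  have h2 : Measurable fun a => ∫⁻ b, T a b ∂ν := hTm.lintegral_prod_right'
  rw [h1, two_mul]
  simp_rw [fun a => lintegral_add_left (μ := ν) (hTa a) (fun b => T b a)]
  rw [lintegral_add_left h2]
  congr 1
  exact lintegral_lintegral_swap (hTm.comp measurable_swap).aemeasurable

lemma lintegral_symm_three {W : ℝ → ℝ → ℝ → ℝ≥0∞}
    (hW : Measurable fun q : ℝ × ℝ × ℝ => W q.1 q.2.1 q.2.2)
    (hs : ∀ a b c, W a b c = W b a c) (hs' : ∀ a b c, W a b c = W a c b) :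
    ∫⁻ a, ∫⁻ b, ∫⁻ c, W a b c ∂ν ∂ν ∂ν =
      6 * ∫⁻ a, ∫⁻ b, ∫⁻ c, (if a < b ∧ b < c then W a b c else 0) ∂ν ∂ν ∂ν := by
  set T : ℝ → ℝ → ℝ → ℝ≥0∞ := fun a b c => if a < b ∧ b < c then W a b c else 0 with hT
  have hTm : Measurable fun q : ℝ × ℝ × ℝ => T q.1 q.2.1 q.2.2 :=
    Measurable.ite ((measurableSet_lt measurable_fst measurable_snd.fst).inter
      (measurableSet_lt measurable_snd.fst measurable_snd.snd)) hW measurable_const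
  have swap1 : ∀ F : ℝ → ℝ → ℝ → ℝ≥0∞, (Measurable fun q : ℝ × ℝ × ℝ => F q.1 q.2.1 q.2.2) →
      ∫⁻ a, ∫⁻ b, ∫⁻ c, F b a c ∂ν ∂ν ∂ν = ∫⁻ a, ∫⁻ b, ∫⁻ c, F a b c ∂ν ∂ν ∂ν := by
    intro F hF
    refine lintegral_lintegral_swap (Measurable.aemeasurable ?_)
    exact Measurable.lintegral_prod_right' (f := fun z : (ℝ × ℝ) × ℝ => F z.1.2 z.1.1 z.2)
      (hF.comp (f := fun z : (ℝ × ℝ) × ℝ => (z.1.2, z.1.1, z.2)) (by fun_prop))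
  have swap2 : ∀ F : ℝ → ℝ → ℝ → ℝ≥0∞, (Measurable fun q : ℝ × ℝ × ℝ => F q.1 q.2.1 q.2.2) →
      ∫⁻ a, ∫⁻ b, ∫⁻ c, F a c b ∂ν ∂ν ∂ν = ∫⁻ a, ∫⁻ b, ∫⁻ c, F a b c ∂ν ∂ν ∂ν := by
    intro F hF
    refine lintegral_congr fun a => lintegral_lintegral_swap (Measurable.aemeasurable ?_)
    exact hF.comp (f := fun z : ℝ × ℝ => (a, z.2, z.1)) (by fun_prop)
  have hsplit : ∫⁻ a, ∫⁻ b, ∫⁻ c, W a b c ∂ν ∂ν ∂ν = ∫⁻ a, ∫⁻ b, ∫⁻ c,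
      (T a b c + T a c b + T b a c + T b c a + T c a b + T c b a) ∂ν ∂ν ∂ν := by
    refine lintegral_congr fun a => lintegral_congr_ae ?_
    filter_upwards [Measure.ae_ne ν a] with b hb
    refine lintegral_congr_ae ?_
    filter_upwards [Measure.ae_ne ν a, Measure.ae_ne ν b] with c hc hc'
    have e1 : W a c b = W a b c := (hs' a b c).symm
    have e2 : W b a c = W a b c := (hs a b c).symm
    have e3 : W b c a = W a b c := by rw [← hs' b a c, e2]
    have e4 : W c a b = W a b c := by rw [← hs a c b, e1]
    have e5 : W c b a = W a b c := by rw [← hs' c a b, e4]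
    simp only [hT, e1, e2, e3, e4, e5]
    rcases lt_or_gt_of_ne hb with h1 | h1 <;> rcases lt_or_gt_of_ne hc with h2 | h2 <;>
      rcases lt_or_gt_of_ne hc' with h3 | h3 <;>
      first
        | (exfalso; linarith)
        | simp [h1, h2, h3, h1.not_gt, h2.not_gt, h3.not_gt]
  have hm := fun (f : ℝ × ℝ × ℝ → ℝ × ℝ × ℝ) (hf : Measurable f) => hTm.comp hf
  have add3 : ∀ F G : ℝ → ℝ → ℝ → ℝ≥0∞, (Measurable fun q : ℝ × ℝ × ℝ => F q.1 q.2.1 q.2.2) →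
      ∫⁻ a, ∫⁻ b, ∫⁻ c, (F a b c + G a b c) ∂ν ∂ν ∂ν =
        (∫⁻ a, ∫⁻ b, ∫⁻ c, F a b c ∂ν ∂ν ∂ν) + ∫⁻ a, ∫⁻ b, ∫⁻ c, G a b c ∂ν ∂ν ∂ν := by
    intro F G hF
    have h0 : ∀ a b, Measurable (F a b) := fun a b =>
      hF.comp (f := fun c => (a, b, c)) (by fun_prop)
    have h1 : Measurable fun z : ℝ × ℝ => ∫⁻ c, F z.1 z.2 c ∂ν :=
      Measurable.lintegral_prod_right' (f := fun z : (ℝ × ℝ) × ℝ => F z.1.1 z.1.2 z.2)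
        (hF.comp (f := fun z : (ℝ × ℝ) × ℝ => (z.1.1, z.1.2, z.2)) (by fun_prop))
    have h2 : Measurable fun a => ∫⁻ b, ∫⁻ c, F a b c ∂ν ∂ν := h1.lintegral_prod_right'
    have h3 : ∀ a, Measurable fun b => ∫⁻ c, F a b c ∂ν := fun a =>
      h1.comp (f := fun b => (a, b)) (by fun_prop)
    simp_rw [fun a b => lintegral_add_left (μ := ν) (h0 a b) (G a b),
      fun a => lintegral_add_left (μ := ν) (h3 a) (fun b => ∫⁻ c, G a b c ∂ν)]
    rw [lintegral_add_left h2]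
  have m2 : Measurable fun q : ℝ × ℝ × ℝ => T q.1 q.2.2 q.2.1 :=
    hm (fun q => (q.1, q.2.2, q.2.1)) (by fun_prop)
  have m3 : Measurable fun q : ℝ × ℝ × ℝ => T q.2.1 q.1 q.2.2 :=
    hm (fun q => (q.2.1, q.1, q.2.2)) (by fun_prop)
  have m4 : Measurable fun q : ℝ × ℝ × ℝ => T q.2.1 q.2.2 q.1 :=
    hm (fun q => (q.2.1, q.2.2, q.1)) (by fun_prop)
  have m5 : Measurable fun q : ℝ × ℝ × ℝ => T q.2.2 q.1 q.2.1 :=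
    hm (fun q => (q.2.2, q.1, q.2.1)) (by fun_prop)
  have i2 := swap2 T hTm
  have i3 := swap1 T hTm
  have i4 := (swap1 (fun a b c => T a c b) m2).trans i2
  have i5 := (swap2 (fun a b c => T b a c) m3).trans i3
  have i6 := (swap1 (fun a b c => T c a b) m5).trans i5
  rw [hsplit, add3 _ _ ((((hTm.add m2).add m3).add m4).add m5),
    add3 _ _ (((hTm.add m2).add m3).add m4), add3 _ _ ((hTm.add m2).add m3),
    add3 _ _ (hTm.add m2), add3 _ _ hTm, i2, i3, i4, i5, i6]
  ring

end OrderedIntegrals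

section KernelIntegrals

/-- The integrand of the kernel: `∑ τ, (s - x₁)_+^γ_τ (s - x₂)_+^γ_τ'`, where `τ'` is the other
index. -/
def pairKernel (γ : Fin 2 → ℝ) (s : ℝ) (x : ℝ × ℝ) : ℝ≥0∞ :=
  ∑ i : Fin 2, epow (γ i) (s - x.1) * epow (γ i.rev) (s - x.2)

/-- The cross-correlation of two truncated powers. -/
def powCorr (γ : Fin 2 → ℝ) (i j : Fin 2) (s t : ℝ) : ℝ≥0∞ :=
  ∫⁻ x, epow (γ i) (s - x) * epow (γ j) (t - x)

/-- The function `∫₀¹ ∑ τ, (s - x₁)_+^γ_τ (s - x₂)_+^γ_τ' ds` with values in `[0, ∞]`. -/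
def intPairKernel (γ : Fin 2 → ℝ) (x : ℝ × ℝ) : ℝ≥0∞ :=
  ∫⁻ s in Set.Ioc 0 1, pairKernel γ s x

variable {γ : Fin 2 → ℝ}

lemma powCorr_comm (i j : Fin 2) (s t : ℝ) : powCorr γ i j s t = powCorr γ j i t s :=
  lintegral_congr fun _ => mul_comm _ _

lemma powCorr_of_lt (hγ : ∀ i, γ i ∈ Set.Ioo (-1 : ℝ) (-1 / 2)) (i j : Fin 2) {s t : ℝ}
    (hst : s < t) :
    powCorr γ i j s t = ENNReal.ofReal (beta (γ i + 1) (-γ i - γ j - 1)) *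
      epow (γ i + γ j + 1) (t - s) :=
  lintegral_epow_sub_mul_epow_sub (hγ i).1 (by linarith [(hγ i).2, (hγ j).2])
    (by linarith [(hγ j).2]) hst

@[fun_prop]
lemma measurable_pairKernel_comp {α : Type*} [MeasurableSpace α] {f : α → ℝ} {g : α → ℝ × ℝ}
    (hf : Measurable f) (hg : Measurable g) : Measurable fun a => pairKernel γ (f a) (g a) := by
  unfold pairKernel
  fun_prop

@[fun_prop]
lemma measurable_intPairKernel : Measurable (intPairKernel γ) :=
  Measurable.lintegral_prod_right' (f := fun z : (ℝ × ℝ) × ℝ => pairKernel γ z.2 z.1) (by fun_prop)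

@[fun_prop]
lemma measurable_powCorr (i j : Fin 2) : Measurable (Function.uncurry (powCorr γ i j)) := by
  unfold powCorr Function.uncurry
  exact Measurable.lintegral_prod_right' (f := fun z : (ℝ × ℝ) × ℝ =>
    epow (γ i) (z.1.1 - z.2) * epow (γ j) (z.1.2 - z.2)) (by fun_prop)

lemma lintegral_pairKernel_mul (s t : ℝ) :
    ∫⁻ x, pairKernel γ s x * pairKernel γ t x =
      ∑ i : Fin 2, ∑ j : Fin 2, powCorr γ i j s t * powCorr γ i.rev j.rev s t := by
  have h : ∀ x : ℝ × ℝ, pairKernel γ s x * pairKernel γ t x = ∑ i : Fin 2, ∑ j : Fin 2,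
      (epow (γ i) (s - x.1) * epow (γ j) (t - x.1)) *
        (epow (γ i.rev) (s - x.2) * epow (γ j.rev) (t - x.2)) := by
    intro x
    simp only [pairKernel]
    rw [Finset.sum_mul_sum]
    exact Finset.sum_congr rfl fun i _ => Finset.sum_congr rfl fun j _ => by ring
  simp_rw [h]
  rw [lintegral_finsetSum _ fun i _ => by fun_prop]
  refine Finset.sum_congr rfl fun i _ => ?_
  rw [lintegral_finsetSum _ fun j _ => by fun_prop]
  refine Finset.sum_congr rfl fun j _ => ?_
  rw [Measure.volume_eq_prod]
  exact lintegral_prod_mul (f := fun x => epow (γ i) (s - x) * epow (γ j) (t - x))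
    (g := fun x => epow (γ i.rev) (s - x) * epow (γ j.rev) (t - x)) (by fun_prop) (by fun_prop)

/-- The cyclic sum of products of three cross-correlations. -/
def cyclicCorr (γ : Fin 2 → ℝ) (a b c : ℝ) : ℝ≥0∞ :=
  ∑ i : Fin 2, ∑ j : Fin 2, ∑ k : Fin 2,
    powCorr γ i k.rev a c * powCorr γ i.rev j a b * powCorr γ j.rev k b c

lemma lintegral_pairKernel_cyclic (a b c : ℝ) :
    ∫⁻ p : ℝ × ℝ × ℝ, pairKernel γ a (p.1, p.2.1) * pairKernel γ b p.2 *
      pairKernel γ c (p.2.2, p.1) = cyclicCorr γ a b c := by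
  have h : ∀ p : ℝ × ℝ × ℝ, pairKernel γ a (p.1, p.2.1) * pairKernel γ b p.2 *
      pairKernel γ c (p.2.2, p.1) = ∑ i : Fin 2, ∑ j : Fin 2, ∑ k : Fin 2,
      (epow (γ i) (a - p.1) * epow (γ k.rev) (c - p.1)) *
        ((epow (γ i.rev) (a - p.2.1) * epow (γ j) (b - p.2.1)) *
          (epow (γ j.rev) (b - p.2.2) * epow (γ k) (c - p.2.2))) := by
    intro p
    simp only [pairKernel]
    rw [Finset.sum_mul_sum]
    simp_rw [Finset.sum_mul, Finset.mul_sum]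
    exact Finset.sum_congr rfl fun i _ => Finset.sum_congr rfl fun j _ =>
      Finset.sum_congr rfl fun k _ => by ring
  simp_rw [h]
  rw [lintegral_finsetSum _ fun i _ => by fun_prop]
  refine Finset.sum_congr rfl fun i _ => ?_
  rw [lintegral_finsetSum _ fun j _ => by fun_prop]
  refine Finset.sum_congr rfl fun j _ => ?_
  rw [lintegral_finsetSum _ fun j _ => by fun_prop]
  refine Finset.sum_congr rfl fun k _ => ?_
  rw [Measure.volume_eq_prod, mul_assoc]
  refine (lintegral_prod_mul (f := fun x => epow (γ i) (a - x) * epow (γ k.rev) (c - x))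
    (g := fun q : ℝ × ℝ => (epow (γ i.rev) (a - q.1) * epow (γ j) (b - q.1)) *
          (epow (γ j.rev) (b - q.2) * epow (γ k) (c - q.2))) (by fun_prop) (by fun_prop)).trans ?_
  congr 1
  rw [Measure.volume_eq_prod]
  exact lintegral_prod_mul (f := fun x => epow (γ i.rev) (a - x) * epow (γ j) (b - x))
    (g := fun x => epow (γ j.rev) (b - x) * epow (γ k) (c - x)) (by fun_prop) (by fun_prop)

lemma cyclicCorr_swap_left (a b c : ℝ) : cyclicCorr γ a b c = cyclicCorr γ b a c := by
  simp only [cyclicCorr, Fin.sum_univ_two, fun i j => powCorr_comm (γ := γ) i j b a]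
  simp only [Fin.rev_zero, Fin.isValue, Fin.reduceLast, Fin.reduceRev]
  ring

lemma cyclicCorr_swap_right (a b c : ℝ) : cyclicCorr γ a b c = cyclicCorr γ a c b := by
  simp only [cyclicCorr, Fin.sum_univ_two, fun i j => powCorr_comm (γ := γ) i j c b]
  simp only [Fin.rev_zero, Fin.isValue, Fin.reduceLast, Fin.reduceRev]
  ring

lemma measurable_cyclicCorr :
    Measurable fun q : ℝ × ℝ × ℝ => cyclicCorr γ q.1 q.2.1 q.2.2 := by
  unfold cyclicCorr
  refine Finset.measurable_sum _ fun i _ => Finset.measurable_sum _ fun j _ =>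
    Finset.measurable_sum _ fun k _ => ?_
  refine (Measurable.mul ?_ ?_).mul ?_
  · exact (measurable_powCorr i k.rev).comp (f := fun q : ℝ × ℝ × ℝ => (q.1, q.2.2)) (by fun_prop)
  · exact (measurable_powCorr i.rev j).comp (f := fun q : ℝ × ℝ × ℝ => (q.1, q.2.1)) (by fun_prop)
  · exact (measurable_powCorr j.rev k).comp (f := fun q : ℝ × ℝ × ℝ => q.2) (by fun_prop)

lemma lintegral_intPairKernel_sq_eq :
    ∫⁻ x, intPairKernel γ x * intPairKernel γ x =
      ∫⁻ a in Set.Ioc 0 1, ∫⁻ b in Set.Ioc 0 1, ∫⁻ x, pairKernel γ a x * pairKernel γ b x := by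
  set ν : Measure ℝ := volume.restrict (Set.Ioc 0 1)
  have hk : ∀ x, Measurable fun s => pairKernel γ s x := fun x => by fun_prop
  have h1 : ∀ x, intPairKernel γ x * intPairKernel γ x =
      ∫⁻ q : ℝ × ℝ, pairKernel γ q.1 x * pairKernel γ q.2 x ∂(ν.prod ν) := fun x =>
    (lintegral_prod_mul (hk x).aemeasurable (hk x).aemeasurable).symm
  have m1 : Measurable fun z : (ℝ × ℝ) × ℝ × ℝ => pairKernel γ z.2.1 z.1 * pairKernel γ z.2.2 z.1 := by
    fun_prop
  simp_rw [h1]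
  rw [lintegral_lintegral_swap m1.aemeasurable, lintegral_prod]
  exact (m1.comp measurable_swap).lintegral_prod_right'.aemeasurable

lemma lintegral_intPairKernel_cyclic_eq :
    ∫⁻ p : ℝ × ℝ × ℝ, intPairKernel γ (p.1, p.2.1) * intPairKernel γ p.2 *
      intPairKernel γ (p.2.2, p.1) =
      ∫⁻ a in Set.Ioc 0 1, ∫⁻ b in Set.Ioc 0 1, ∫⁻ c in Set.Ioc 0 1, cyclicCorr γ a b c := by
  set ν : Measure ℝ := volume.restrict (Set.Ioc 0 1)
  have hk : ∀ x, Measurable fun s => pairKernel γ s x := fun x => by fun_prop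
  have h1 : ∀ p : ℝ × ℝ × ℝ, intPairKernel γ (p.1, p.2.1) * intPairKernel γ p.2 *
      intPairKernel γ (p.2.2, p.1) = ∫⁻ q : ℝ × ℝ × ℝ, pairKernel γ q.1 (p.1, p.2.1) *
        (pairKernel γ q.2.1 p.2 * pairKernel γ q.2.2 (p.2.2, p.1)) ∂(ν.prod (ν.prod ν)) := by
    intro p
    rw [mul_assoc]
    have e1 := lintegral_prod_mul (μ := ν) (ν := ν) (hk p.2).aemeasurable
      (hk (p.2.2, p.1)).aemeasurable
    have e2 := lintegral_prod_mul (μ := ν) (ν := ν.prod ν) (hk (p.1, p.2.1)).aemeasurable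
      (g := fun q => pairKernel γ q.1 p.2 * pairKernel γ q.2 (p.2.2, p.1))
      (((hk p.2).comp measurable_fst).mul ((hk (p.2.2, p.1)).comp measurable_snd)).aemeasurable
    rw [e2, e1]
    rfl
  have m1 : Measurable fun z : (ℝ × ℝ × ℝ) × ℝ × ℝ × ℝ => pairKernel γ z.2.1 (z.1.1, z.1.2.1) *
        (pairKernel γ z.2.2.1 z.1.2 * pairKernel γ z.2.2.2 (z.1.2.2, z.1.1)) := by
    fun_prop
  simp_rw [h1]
  rw [lintegral_lintegral_swap m1.aemeasurable]
  simp_rw [← mul_assoc, lintegral_pairKernel_cyclic]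
  have m2 := measurable_cyclicCorr (γ := γ)
  rw [lintegral_prod _ m2.aemeasurable]
  refine lintegral_congr fun a => ?_
  rw [lintegral_prod]
  exact (m2.comp (f := fun q : ℝ × ℝ => (a, q.1, q.2)) (by fun_prop)).aemeasurable

/-- The squared `L²` norm of the kernel. -/
lemma lintegral_intPairKernel_sq (hγ : ∀ i, γ i ∈ Set.Ioo (-1 : ℝ) (-1 / 2))
    (hsum : -3 / 2 < γ 0 + γ 1) :
    ∫⁻ x, intPairKernel γ x * intPairKernel γ x = ENNReal.ofReal
      (2 * betaBracket (γ 0) (γ 1) / ((2 * (γ 0 + γ 1) + 3) * (γ 0 + γ 1 + 2))) := by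
  have hb : ∀ i j, 0 < beta (γ i + 1) (-γ i - γ j - 1) := fun i j =>
    beta_pos (by linarith [(hγ i).1]) (by linarith [(hγ i).2, (hγ j).2])
  have hB : betaBracket (γ 0) (γ 1) = beta (γ 0 + 1) (-γ 0 - γ 1 - 1) *
      beta (γ 1 + 1) (-γ 1 - γ 0 - 1) + beta (γ 0 + 1) (-γ 0 - γ 0 - 1) *
      beta (γ 1 + 1) (-γ 1 - γ 1 - 1) := by
    rw [betaBracket]; ring_nf
  have hB0 : 0 < betaBracket (γ 0) (γ 1) := by
    rw [hB]
    have := hb 0 1; have := hb 1 0; have := hb 0 0; have := hb 1 1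
    positivity
  set W : ℝ → ℝ → ℝ≥0∞ := fun a b => ∫⁻ x, pairKernel γ a x * pairKernel γ b x with hW
  have hWm : Measurable (Function.uncurry W) := by
    have m1 : Measurable fun z : (ℝ × ℝ) × ℝ × ℝ =>
        pairKernel γ z.1.1 z.2 * pairKernel γ z.1.2 z.2 := by
      fun_prop
    exact m1.lintegral_prod_right'
  have hWs : ∀ a b, W a b = W b a := fun a b => lintegral_congr fun x => mul_comm _ _
  set e : ℝ := 2 * (γ 0 + γ 1) + 2 with he
  have hWlt : ∀ a b, a < b → W a b = ENNReal.ofReal (2 * betaBracket (γ 0) (γ 1)) *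
      epow e (b - a) := by
    intro a b hab
    have he1 : e = (γ 0 + γ 1 + 1) + (γ 1 + γ 0 + 1) := by rw [he]; ring
    have he2 : e = (γ 0 + γ 0 + 1) + (γ 1 + γ 1 + 1) := by rw [he]; ring
    have p1 : powCorr γ 0 1 a b * powCorr γ 1 0 a b = ENNReal.ofReal
        (beta (γ 0 + 1) (-γ 0 - γ 1 - 1) * beta (γ 1 + 1) (-γ 1 - γ 0 - 1)) * epow e (b - a) := by
      rw [powCorr_of_lt hγ _ _ hab, powCorr_of_lt hγ _ _ hab, he1,
        ← epow_mul_epow (γ 0 + γ 1 + 1) (γ 1 + γ 0 + 1),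
        ENNReal.ofReal_mul (hb 0 1).le]
      ring
    have p2 : powCorr γ 0 0 a b * powCorr γ 1 1 a b = ENNReal.ofReal
        (beta (γ 0 + 1) (-γ 0 - γ 0 - 1) * beta (γ 1 + 1) (-γ 1 - γ 1 - 1)) * epow e (b - a) := by
      rw [powCorr_of_lt hγ _ _ hab, powCorr_of_lt hγ _ _ hab, he2,
        ← epow_mul_epow (γ 0 + γ 0 + 1) (γ 1 + γ 1 + 1),
        ENNReal.ofReal_mul (hb 0 0).le]
      ring
    have hexp : W a b = 2 * (powCorr γ 0 1 a b * powCorr γ 1 0 a b +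
        powCorr γ 0 0 a b * powCorr γ 1 1 a b) := by
      simp only [hW]
      rw [lintegral_pairKernel_mul]
      simp only [Fin.sum_univ_two, Fin.rev_zero, Fin.isValue, Fin.reduceLast,
        Fin.reduceRev]
      ring
    have q1 := mul_pos (hb 0 1) (hb 1 0)
    have q2 := mul_pos (hb 0 0) (hb 1 1)
    rw [hexp, p1, p2, ← add_mul, ← ENNReal.ofReal_add q1.le q2.le, ← hB,
      ENNReal.ofReal_mul (by norm_num), ENNReal.ofReal_ofNat, mul_assoc]
  rw [lintegral_intPairKernel_sq_eq]
  change ∫⁻ a in Set.Ioc 0 1, ∫⁻ b in Set.Ioc 0 1, W a b = _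
  rw [lintegral_symm_two hWm hWs]
  simp_rw [setLIntegral_unit_eq]
  have hpt : ∀ a b, epow 0 a * epow 0 (1 - a) * (epow 0 b * epow 0 (1 - b) *
      (if a < b then W a b else 0)) = ENNReal.ofReal (2 * betaBracket (γ 0) (γ 1)) *
        (epow 0 a * epow 0 (1 - b) * epow e (b - a)) := by
    intro a b
    split_ifs with hab
    · rw [hWlt a b hab]
      rcases le_or_gt a 0 with ha | ha
      · simp [epow_of_nonpos ha]
      rcases le_or_gt 1 b with hb' | hb'
      · simp [epow_of_nonpos (sub_nonpos.2 hb')]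
      rw [epow_of_pos ha, epow_of_pos (u := 1 - a) (by linarith), epow_of_pos (u := b)
        (by linarith), epow_of_pos (u := 1 - b) (by linarith)]
      simp
    · rw [epow_of_nonpos (u := b - a) (by linarith)]
      simp
  have hne : ∀ a, epow 0 a * epow 0 (1 - a) ≠ ∞ := fun a =>
    ENNReal.mul_ne_top (epow_ne_top _ _) (epow_ne_top _ _)
  have hm : Measurable fun a => ∫⁻ b, epow 0 a * epow 0 (1 - b) * epow e (b - a) :=
    Measurable.lintegral_prod_right' (f := fun z : ℝ × ℝ =>
      epow 0 z.1 * epow 0 (1 - z.2) * epow e (z.2 - z.1)) (by fun_prop)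
  simp_rw [← fun a => lintegral_const_mul' (μ := (volume : Measure ℝ)) _
    (fun b => epow 0 b * epow 0 (1 - b) * if a < b then W a b else 0) (hne a), hpt,
    fun a => lintegral_const_mul' (μ := (volume : Measure ℝ)) _
      (fun b => epow 0 a * epow 0 (1 - b) * epow e (b - a))
      (ENNReal.ofReal_ne_top (r := 2 * betaBracket (γ 0) (γ 1)))]
  rw [lintegral_const_mul _ hm, lintegral_ordered_two (by linarith), ← ENNReal.ofReal_mul
    (by positivity), ← ENNReal.ofReal_ofNat 2, ← ENNReal.ofReal_mul (by norm_num)]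
  congr 1
  have h1 : 2 * (γ 0 + γ 1) + 3 ≠ 0 := by linarith
  have h2 : γ 0 + γ 1 + 2 ≠ 0 := by linarith
  have h3 : e + 1 = 2 * (γ 0 + γ 1) + 3 := by rw [he]; ring
  have h4 : e + 2 = 2 * (γ 0 + γ 1 + 2) := by rw [he]; ring
  rw [h3, h4]
  field_simp

end KernelIntegrals

section CyclicIntegral

/-- The product of the beta functions that belong to one choice of the indices. -/
def cyclicTerm (γ : Fin 2 → ℝ) (i j k : Fin 2) : ℝ :=
  beta (γ i + 1) (-γ i - γ k.rev - 1) * beta (γ i.rev + 1) (-γ i.rev - γ j - 1) *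
    beta (γ j.rev + 1) (-γ j.rev - γ k - 1) * beta (γ i.rev + γ j + 2) (γ j.rev + γ k + 2)

lemma factorF2_eq (γ₁ γ₂ : ℝ) :
    factorF2 γ₁ γ₂ = ∑ σ : Fin 2 × Fin 2 × Fin 2, cyclicTerm ![γ₁, γ₂] σ.1 σ.2.1 σ.2.2 := by
  simp only [factorF2]
  refine Fintype.sum_bijective (fun σ : Fin 3 → Fin 2 => (σ 0, σ 1, σ 2)) ?_ _ _ fun σ => rfl
  constructor
  · intro σ τ h
    simp only [Prod.mk.injEq] at h
    ext i
    fin_cases i <;> simp [h.1, h.2.1, h.2.2]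
  · rintro ⟨i, j, k⟩
    exact ⟨![i, j, k], rfl⟩

lemma add_rev_fin_two (γ : Fin 2 → ℝ) (i : Fin 2) : γ i + γ i.rev = γ 0 + γ 1 := by
  fin_cases i
  · rfl
  · exact add_comm _ _

lemma lintegral_three_eq_prod {f : ℝ → ℝ → ℝ → ℝ≥0∞}
    (hf : Measurable fun q : ℝ × ℝ × ℝ => f q.1 q.2.1 q.2.2) :
    ∫⁻ a, ∫⁻ b, ∫⁻ c, f a b c = ∫⁻ q : ℝ × ℝ × ℝ, f q.1 q.2.1 q.2.2 := by
  rw [Measure.volume_eq_prod, lintegral_prod _ hf.aemeasurable]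
  refine lintegral_congr fun a => ?_
  rw [Measure.volume_eq_prod, lintegral_prod]
  exact (hf.comp (f := fun q : ℝ × ℝ => (a, q.1, q.2)) (by fun_prop)).aemeasurable

variable {γ : Fin 2 → ℝ}

lemma lintegral_intPairKernel_cyclic (hγ : ∀ i, γ i ∈ Set.Ioo (-1 : ℝ) (-1 / 2))
    (hsum : -3 / 2 < γ 0 + γ 1) :
    ∫⁻ p : ℝ × ℝ × ℝ, intPairKernel γ (p.1, p.2.1) * intPairKernel γ p.2 *
      intPairKernel γ (p.2.2, p.1) = ENNReal.ofReal (6 *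
        (∑ σ : Fin 2 × Fin 2 × Fin 2, cyclicTerm γ σ.1 σ.2.1 σ.2.2) /
        ((3 * (γ 0 + γ 1) + 5) * (3 * (γ 0 + γ 1) + 6))) := by
  have hb : ∀ i j, 0 < beta (γ i + 1) (-γ i - γ j - 1) := fun i j =>
    beta_pos (by linarith [(hγ i).1]) (by linarith [(hγ i).2, (hγ j).2])
  have hb' : ∀ i j k l, 0 < beta (γ i + γ j + 2) (γ k + γ l + 2) := fun i j k l =>
    beta_pos (by linarith [(hγ i).1, (hγ j).1]) (by linarith [(hγ k).1, (hγ l).1])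
  set β : Fin 2 × Fin 2 × Fin 2 → ℝ := fun σ =>
    beta (γ σ.1 + 1) (-γ σ.1 - γ σ.2.2.rev - 1) *
    beta (γ σ.1.rev + 1) (-γ σ.1.rev - γ σ.2.1 - 1) *
    beta (γ σ.2.1.rev + 1) (-γ σ.2.1.rev - γ σ.2.2 - 1) with hβ
  have hβ0 : ∀ σ, 0 < β σ := fun σ => mul_pos (mul_pos (hb _ _) (hb _ _)) (hb _ _)
  set E : Fin 2 × Fin 2 × Fin 2 → ℝ → ℝ → ℝ → ℝ≥0∞ := fun σ a b c =>
    epow 0 a * epow 0 (1 - c) * (epow (γ σ.1 + γ σ.2.2.rev + 1) (c - a) *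
      epow (γ σ.1.rev + γ σ.2.1 + 1) (b - a) * epow (γ σ.2.1.rev + γ σ.2.2 + 1) (c - b)) with hE
  have hEm : ∀ σ, Measurable fun q : ℝ × ℝ × ℝ => E σ q.1 q.2.1 q.2.2 := fun σ => by
    simp only [hE]; fun_prop
  rw [lintegral_intPairKernel_cyclic_eq, lintegral_symm_three measurable_cyclicCorr
    cyclicCorr_swap_left cyclicCorr_swap_right]
  simp_rw [setLIntegral_unit_eq]
  have hpt : ∀ a b c, epow 0 a * epow 0 (1 - a) * (epow 0 b * epow 0 (1 - b) *
      (epow 0 c * epow 0 (1 - c) * (if a < b ∧ b < c then cyclicCorr γ a b c else 0))) =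
      ∑ σ, ENNReal.ofReal (β σ) * E σ a b c := by
    intro a b c
    by_cases h : a < b ∧ b < c
    · obtain ⟨hab, hbc⟩ := h
      have hac := hab.trans hbc
      rw [if_pos ⟨hab, hbc⟩]
      have hexp : cyclicCorr γ a b c = ∑ σ : Fin 2 × Fin 2 × Fin 2, ENNReal.ofReal (β σ) *
          (epow (γ σ.1 + γ σ.2.2.rev + 1) (c - a) *
          epow (γ σ.1.rev + γ σ.2.1 + 1) (b - a) *
          epow (γ σ.2.1.rev + γ σ.2.2 + 1) (c - b)) := by
        simp_rw [Fintype.sum_prod_type, cyclicCorr]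
        refine Finset.sum_congr rfl fun i _ => Finset.sum_congr rfl fun j _ =>
          Finset.sum_congr rfl fun k _ => ?_
        rw [powCorr_of_lt hγ _ _ hac, powCorr_of_lt hγ _ _ hab, powCorr_of_lt hγ _ _ hbc]
        simp only [hβ]
        rw [ENNReal.ofReal_mul (mul_pos (hb _ _) (hb _ _)).le, ENNReal.ofReal_mul (hb _ _).le]
        ring
      rcases le_or_gt a 0 with ha | ha
      · simp [hE, epow_of_nonpos ha]
      rcases le_or_gt 1 c with hc | hc
      · simp [hE, epow_of_nonpos (sub_nonpos.2 hc)]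
      simp only [hE]
      rw [hexp, epow_of_pos ha, epow_of_pos (u := 1 - a) (by linarith), epow_of_pos (u := b)
        (by linarith), epow_of_pos (u := 1 - b) (by linarith), epow_of_pos (u := c)
        (by linarith), epow_of_pos (u := 1 - c) (by linarith)]
      simp
    · rw [if_neg h]
      rw [not_and_or, not_lt, not_lt] at h
      rcases h with h | h
      · simp [hE, epow_of_nonpos (sub_nonpos.2 h)]
      · simp [hE, epow_of_nonpos (sub_nonpos.2 h)]
  have hne : ∀ a, epow 0 a * epow 0 (1 - a) ≠ ∞ := fun a =>
    ENNReal.mul_ne_top (epow_ne_top _ _) (epow_ne_top _ _)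
  simp_rw [← fun a (f : ℝ → ℝ≥0∞) => lintegral_const_mul' (μ := (volume : Measure ℝ)) _ f (hne a),
    hpt]
  rw [lintegral_three_eq_prod (Finset.measurable_sum _ fun σ _ => (hEm σ).const_mul _),
    lintegral_finsetSum _ fun σ _ => (hEm σ).const_mul _]
  have hval : ∀ σ, ∫⁻ q : ℝ × ℝ × ℝ, ENNReal.ofReal (β σ) * E σ q.1 q.2.1 q.2.2 =
      ENNReal.ofReal (cyclicTerm γ σ.1 σ.2.1 σ.2.2 /
        ((3 * (γ 0 + γ 1) + 5) * (3 * (γ 0 + γ 1) + 6))) := by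
    intro σ
    have s1 := add_rev_fin_two γ σ.1
    have s2 := add_rev_fin_two γ σ.2.1
    have s3 := add_rev_fin_two γ σ.2.2
    rw [lintegral_const_mul _ (hEm σ), ← lintegral_three_eq_prod (hEm σ),
      lintegral_ordered_three (by linarith [(hγ σ.1.rev).1, (hγ σ.2.1).1])
        (by linarith [(hγ σ.2.1.rev).1, (hγ σ.2.2).1]) (by linarith),
      ← ENNReal.ofReal_mul, ← ENNReal.ofReal_mul (hβ0 σ).le]
    · congr 1
      have e1 : γ σ.1.rev + γ σ.2.1 + 1 + (γ σ.2.1.rev + γ σ.2.2 + 1) +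
          (γ σ.1 + γ σ.2.2.rev + 1) + 2 = 3 * (γ 0 + γ 1) + 5 := by linarith
      have e2 : γ σ.1.rev + γ σ.2.1 + 1 + (γ σ.2.1.rev + γ σ.2.2 + 1) +
          (γ σ.1 + γ σ.2.2.rev + 1) + 3 = 3 * (γ 0 + γ 1) + 6 := by linarith
      rw [e1, e2, add_assoc (γ σ.1.rev + γ σ.2.1), add_assoc (γ σ.2.1.rev + γ σ.2.2)]
      rw [one_add_one_eq_two, cyclicTerm, mul_one_div, ← mul_div_assoc]
    · rw [add_assoc (γ σ.1.rev + γ σ.2.1), add_assoc (γ σ.2.1.rev + γ σ.2.2)]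
      norm_num
      exact (hb' _ _ _ _).le
  simp_rw [hval]
  have h5 : 0 < 3 * (γ 0 + γ 1) + 5 := by linarith
  have h6 : 0 < 3 * (γ 0 + γ 1) + 6 := by linarith
  have ht : ∀ σ : Fin 2 × Fin 2 × Fin 2, 0 ≤ cyclicTerm γ σ.1 σ.2.1 σ.2.2 := fun σ =>
    (mul_pos (hβ0 σ) (hb' _ _ _ _)).le
  rw [← ENNReal.ofReal_sum_of_nonneg fun σ _ => div_nonneg (ht σ) (by positivity),
    ← ENNReal.ofReal_ofNat 6, ← ENNReal.ofReal_mul (by norm_num), ← Finset.sum_div, mul_div_assoc]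

end CyclicIntegral

section RosenblattKernel

variable {γ₁ γ₂ : ℝ}

lemma genRosenblattKernel_one_eq (A : ℝ) (x : ℝ × ℝ) :
    genRosenblattKernel A γ₁ γ₂ 1 x = A / 2 * (intPairKernel ![γ₁, γ₂] x).toReal := by
  have hm : Measurable fun s => posPow (s - x.1) γ₁ * posPow (s - x.2) γ₂ +
      posPow (s - x.1) γ₂ * posPow (s - x.2) γ₁ := by
    have := fun γ y => (measurable_posPow γ).comp (measurable_id.sub_const (y : ℝ))
    exact ((this γ₁ x.1).mul (this γ₂ x.2)).add ((this γ₂ x.1).mul (this γ₁ x.2))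
  have h0 := fun γ s y => posPow_nonneg (s - y) γ
  rw [genRosenblattKernel, intervalIntegral.integral_of_le zero_le_one,
    integral_eq_lintegral_of_nonneg_ae (ae_of_all _ fun s => add_nonneg
      (mul_nonneg (h0 _ _ _) (h0 _ _ _)) (mul_nonneg (h0 _ _ _) (h0 _ _ _)))
      hm.aestronglyMeasurable]
  congr 2
  refine lintegral_congr fun s => ?_
  rw [ENNReal.ofReal_add (mul_nonneg (h0 _ _ _) (h0 _ _ _)) (mul_nonneg (h0 _ _ _) (h0 _ _ _)),
    ENNReal.ofReal_mul (h0 _ _ _), ENNReal.ofReal_mul (h0 _ _ _), pairKernel]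
  simp [Fin.sum_univ_two, epow]

lemma genRosenblattKernel_swap (A : ℝ) (x : ℝ × ℝ) :
    genRosenblattKernel A γ₁ γ₂ 1 x.swap = genRosenblattKernel A γ₁ γ₂ 1 x := by
  simp only [genRosenblattKernel, Prod.fst_swap, Prod.snd_swap]
  congr 2
  ext s
  ring

lemma betaBracket_pos (hγ₁ : γ₁ ∈ Set.Ioo (-1 : ℝ) (-1 / 2))
    (hγ₂ : γ₂ ∈ Set.Ioo (-1 : ℝ) (-1 / 2)) : 0 < betaBracket γ₁ γ₂ := by
  obtain ⟨a1, a2⟩ := hγ₁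
  obtain ⟨b1, b2⟩ := hγ₂
  exact add_pos (mul_pos (beta_pos (by linarith) (by linarith)) (beta_pos (by linarith)
    (by linarith))) (mul_pos (beta_pos (by linarith) (by linarith)) (beta_pos (by linarith)
    (by linarith)))

/-- The moments of the generalized Rosenblatt random variable. -/
theorem moments_genRosenblatt {Ω : Type*} [MeasurableSpace Ω] {P : Measure Ω}
    [IsProbabilityMeasure P] {B : Set ℝ → Ω → ℝ} (hB : IsBrownianRandomMeasure P B)
    (hγ₁ : γ₁ ∈ Set.Ioo (-1 : ℝ) (-1 / 2)) (hγ₂ : γ₂ ∈ Set.Ioo (-1 : ℝ) (-1 / 2))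
    (hsum : -3 / 2 < γ₁ + γ₂) (A : ℝ) :
    MemLp (genRosenblatt P B A γ₁ γ₂ 1) 4 P ∧
    ∫ ω, genRosenblatt P B A γ₁ γ₂ 1 ω ∂P = 0 ∧
    ∫ ω, genRosenblatt P B A γ₁ γ₂ 1 ω ^ 2 ∂P =
      A ^ 2 * (betaBracket γ₁ γ₂ / ((γ₁ + γ₂ + 2) * (2 * (γ₁ + γ₂) + 3))) ∧
    ∫ ω, genRosenblatt P B A γ₁ γ₂ 1 ω ^ 3 ∂P =
      A ^ 3 * (2 * factorF2 γ₁ γ₂ / ((3 * (γ₁ + γ₂) + 5) * (γ₁ + γ₂ + 2))) := by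
  set γ : Fin 2 → ℝ := ![γ₁, γ₂] with hγdef
  have hγ : ∀ i, γ i ∈ Set.Ioo (-1 : ℝ) (-1 / 2) := by
    intro i; fin_cases i
    exacts [hγ₁, hγ₂]
  set f := genRosenblattKernel A γ₁ γ₂ 1 with hf
  have hff : ∀ x, f x = A / 2 * (intPairKernel γ x).toReal := genRosenblattKernel_one_eq A
  have V := lintegral_intPairKernel_sq hγ hsum
  have T := lintegral_intPairKernel_cyclic hγ hsum
  change _ = ENNReal.ofReal (2 * betaBracket γ₁ γ₂ / ((2 * (γ₁ + γ₂) + 3) * (γ₁ + γ₂ + 2))) at V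
  rw [← factorF2_eq] at T
  change _ = ENNReal.ofReal (6 * factorF2 γ₁ γ₂ /
    ((3 * (γ₁ + γ₂) + 5) * (3 * (γ₁ + γ₂) + 6))) at T
  have hm : Measurable (intPairKernel γ) := measurable_intPairKernel
  have hm2 : Measurable fun x => intPairKernel γ x * intPairKernel γ x := by fun_prop
  have hm3 : Measurable fun p : ℝ × ℝ × ℝ => intPairKernel γ (p.1, p.2.1) * intPairKernel γ p.2 *
      intPairKernel γ (p.2.2, p.1) := by fun_prop
  have hf2 : ∀ x, f x ^ 2 = A ^ 2 / 4 * (intPairKernel γ x * intPairKernel γ x).toReal := by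
    intro x; rw [hff, ENNReal.toReal_mul]; ring
  have hMem : MemLp f 2 volume := by
    rw [memLp_two_iff_integrable_sq]
    · simp_rw [hf2]
      exact (integrable_toReal_of_lintegral_ne_top hm2.aemeasurable
        (by rw [V]; exact ENNReal.ofReal_ne_top)).const_mul _
    · rw [show f = fun x => A / 2 * (intPairKernel γ x).toReal from funext hff]
      exact (hm.ennreal_toReal.const_mul _).aestronglyMeasurable
  have hb := betaBracket_pos hγ₁ hγ₂
  have h2 : 0 < γ₁ + γ₂ + 2 := by linarith
  have h3 : 0 < 2 * (γ₁ + γ₂) + 3 := by linarith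
  have h5 : 0 < 3 * (γ₁ + γ₂) + 5 := by linarith
  have i2 : ∫ x, f x ^ 2 = A ^ 2 / 4 *
      (2 * betaBracket γ₁ γ₂ / ((2 * (γ₁ + γ₂) + 3) * (γ₁ + γ₂ + 2))) := by
    simp_rw [hf2]
    rw [integral_const_mul, integral_toReal hm2.aemeasurable
      (ae_lt_top hm2 (by rw [V]; exact ENNReal.ofReal_ne_top)), V, ENNReal.toReal_ofReal
      (by positivity)]
  have hF2 : 0 ≤ factorF2 γ₁ γ₂ := by
    rw [factorF2_eq]
    refine Finset.sum_nonneg fun σ _ => ?_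
    have hb1 : ∀ i j, 0 < beta (γ i + 1) (-γ i - γ j - 1) := fun i j =>
      beta_pos (by linarith [(hγ i).1]) (by linarith [(hγ i).2, (hγ j).2])
    have hb2 : ∀ i j k l, 0 < beta (γ i + γ j + 2) (γ k + γ l + 2) := fun i j k l =>
      beta_pos (by linarith [(hγ i).1, (hγ j).1]) (by linarith [(hγ k).1, (hγ l).1])
    exact (mul_pos (mul_pos (mul_pos (hb1 _ _) (hb1 _ _)) (hb1 _ _)) (hb2 _ _ _ _)).le
  have i3 : cyclicForm f f f = A ^ 3 / 8 *
      (6 * factorF2 γ₁ γ₂ / ((3 * (γ₁ + γ₂) + 5) * (3 * (γ₁ + γ₂) + 6))) := by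
    have hf3 : ∀ p : ℝ × ℝ × ℝ, f (p.1, p.2.1) * f p.2 * f (p.2.2, p.1) = A ^ 3 / 8 *
        (intPairKernel γ (p.1, p.2.1) * intPairKernel γ p.2 *
          intPairKernel γ (p.2.2, p.1)).toReal := by
      intro p
      simp_rw [hff, ENNReal.toReal_mul]
      ring
    have h6 : 0 < 3 * (γ₁ + γ₂) + 6 := by linarith
    rw [cyclicForm]
    simp_rw [hf3]
    rw [integral_const_mul, integral_toReal hm3.aemeasurable
      (ae_lt_top hm3 (by rw [T]; exact ENNReal.ofReal_ne_top)), T, ENNReal.toReal_ofReal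
      (by positivity)]
  obtain ⟨m4, m1, m2, m3⟩ := moments_of_isDoubleWienerIto hB (genRosenblattKernel_swap A)
    (isDoubleWienerIto_doubleWienerIto hB hMem)
  refine ⟨m4, m1, m2.trans ?_, m3.trans ?_⟩
  · rw [← hf, i2]
    field_simp
    ring
  · rw [← hf, i3, show 3 * (γ₁ + γ₂) + 6 = 3 * (γ₁ + γ₂ + 2) by ring]
    field_simp
    ring

end RosenblattKernel
end

theorem corollary1 {Ω : Type*} [MeasurableSpace Ω] (P : Measure Ω) [IsProbabilityMeasure P]
    (B : Set ℝ → Ω → ℝ) (hB : IsBrownianRandomMeasure P B)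
    (γ₁ γ₂ : ℝ) (hγ₁ : γ₁ ∈ Set.Ioo (-1 : ℝ) (-1 / 2)) (hγ₂ : γ₂ ∈ Set.Ioo (-1 : ℝ) (-1 / 2))
    (hsum : -3 / 2 < γ₁ + γ₂) :
    0 < normConst γ₁ γ₂ ∧
    (∀ A : ℝ, 0 < A → (Var[genRosenblatt P B A γ₁ γ₂ 1; P] = 1 ↔ A = normConst γ₁ γ₂)) ∧
    MemLp (genRosenblatt P B (normConst γ₁ γ₂) γ₁ γ₂ 1) 3 P ∧
    ∫ ω, genRosenblatt P B (normConst γ₁ γ₂) γ₁ γ₂ 1 ω ∂P = 0 ∧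
    ∫ ω, (genRosenblatt P B (normConst γ₁ γ₂) γ₁ γ₂ 1 ω) ^ 3 ∂P =
      factorF1 γ₁ γ₂ * factorF2 γ₁ γ₂ * factorF3 γ₁ γ₂ := by
  have hb := betaBracket_pos hγ₁ hγ₂
  have h2 : 0 < γ₁ + γ₂ + 2 := by linarith
  have h3 : 0 < 2 * (γ₁ + γ₂) + 3 := by linarith
  have h5 : 0 < 3 * (γ₁ + γ₂) + 5 := by linarith
  have hN : 0 < normConst γ₁ γ₂ := by unfold normConst; positivity
  have hN2 : normConst γ₁ γ₂ ^ 2 = (γ₁ + γ₂ + 2) * (2 * (γ₁ + γ₂) + 3) / betaBracket γ₁ γ₂ := by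
    rw [normConst, ← Real.rpow_natCast, ← Real.rpow_mul (by positivity)]
    norm_num
  refine ⟨hN, fun A hA => ?_, ?_, ?_, ?_⟩
  · obtain ⟨m4, m1, m2, -⟩ := moments_genRosenblatt hB hγ₁ hγ₂ hsum A
    rw [variance_eq_sub (m4.mono_exponent (by norm_num)), m1]
    simp only [Pi.pow_apply]
    rw [m2, ← pow_left_inj₀ hA.le hN.le two_ne_zero, hN2]
    rw [zero_pow two_ne_zero, sub_zero, ← mul_div_assoc, div_eq_one_iff_eq (by positivity),
      eq_div_iff hb.ne']
  · exact (moments_genRosenblatt hB hγ₁ hγ₂ hsum _).1.mono_exponent (by norm_num)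
  · exact (moments_genRosenblatt hB hγ₁ hγ₂ hsum _).2.1
  · rw [(moments_genRosenblatt hB hγ₁ hγ₂ hsum _).2.2.2]
    have hN3 : normConst γ₁ γ₂ ^ 3 = (γ₁ + γ₂ + 2) ^ (1 / 2 : ℝ) * (γ₁ + γ₂ + 2) *
        (2 * (γ₁ + γ₂) + 3) ^ (3 / 2 : ℝ) * betaBracket γ₁ γ₂ ^ (-3 / 2 : ℝ) := by
      rw [normConst, ← Real.rpow_natCast, ← Real.rpow_mul (by positivity), div_eq_mul_inv,
        Real.mul_rpow (by positivity) (by positivity), Real.mul_rpow h2.le h3.le,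
        Real.inv_rpow hb.le, ← Real.rpow_neg hb.le, ← Real.rpow_add_one h2.ne']
      norm_num
    rw [hN3, factorF1, factorF3]
    field_simp
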